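/- Let $N\ge 2$ be an integer and let $g\in C([0,\infty)\times\mathbb R,\mathbb R)$ be continuously differentiable with respect to its first variable $r$ (that is, $r\mapsto g(r,z)$ is $C^1$ on $[0,\infty)$ for each $z$). Suppose there are positive numbers $\alpha_*,\alpha^*,\lambda,\Lambda$ and a locally Lipschitz continuous function $g_\infty:\mathbb R\to\mathbb R$ such that $g(r,\cdot)\to g_\infty$ uniformly on $[-\alpha_*,\alpha^*]$ as $r\to\infty$ and, for all $r\ge 0$ and $z\in[-\alpha_*,\alpha^*]$, $$g_r(r,z)z\le 0,\qquad \lambda z^2\le g_\infty(z)z\le g(r,z)z\le\Lambda z^2 .$$ Put $G(r,z)=\int_0^z g(r,t)\,dt$, $G_\infty(z)=\int_0^z g_\infty(t)\,dt$, and let $\alpha\in[-\alpha_*,\alpha^*]$ satisfy $$G(0,\alpha)\le\min\{G_\infty(-\alpha_*),G_\infty(\alpha^*)\}.$$ Then there is a solution $u\in C^2(\mathbb R)$, even in $r$, of the radial initial value problem $$-u''-\frac{N-1}{r}u'=g(r,u)\ \text{ in }(0,\infty),\qquad u(0)=\alpha,\quad u'(0)=0,$$ which is oscillating (it has an unbounded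 sequence of zeros) and localized ($u(r)\to0$ as $r\to\infty$), and which satisfies $$\|u\|_{L^\infty(\mathbb R)}\le\max\{\alpha_*,\alpha^*\},\qquad \|u'\|_{L^\infty(\mathbb R)}\le\sqrt{2G(0,\alpha)} .$$ Suppose moreover that there are $\varepsilon\in(0,1)$, $\sigma>0$, $C_0>0$ and an integrable function $k$ on $[\varepsilon^{-1},\infty)$ such that, for all $|z|\le\varepsilon$ and $r\ge\varepsilon^{-1}$, $$|2G(r,z)-zg(r,z)|\le C_0z^2\,\big|\ln|z|\big|^{-1-\sigma},\qquad g_r(r,z)z\ge -k(r)z^2$$ (the right-hand side of the first inequality being read as $0$ for $z=0$). Then there are $c,C>0$ such that for all $r\ge 1$ $$|u(r)|+|u'(r)|+|u''(r)|\le C\,r^{(1-N)/2}\quad\text{and, if }\alpha\ne0,\quad c\,r^{(1-N)/2}\le|u(r)|+|u'(r)|+|u''(r)| .$$ -/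

import Mathlib

/-- The primitive `∫₀^z f(t) dt` in the state variable. For `g : ℝ → ℝ → ℝ`,
`G(r, z)` is `primitive (g r) z`. -/
noncomputable def primitive (f : ℝ → ℝ) (z : ℝ) : ℝ := ∫ t in (0 : ℝ)..z, f t

/-- The partial derivative `g_r(r, z)` for `r ∈ [0, ∞)` (one-sided at `r = 0`). -/
noncomputable def partialR (g : ℝ → ℝ → ℝ) (r z : ℝ) : ℝ :=
  derivWithin (fun s => g s z) (Set.Ici 0) r

/-- `u` is a global classical solution of the radial initial value problem
`-u'' - (N-1)/r u' = g(r,u)` in `(0,∞)`, `u(0) = α`, `u'(0) = 0`. As usual for radial profiles, `u`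
is extended evenly to `ℝ`, and it is twice continuously differentiable there. -/
structure IsRadialSolution (N : ℕ) (g : ℝ → ℝ → ℝ) (α : ℝ) (u : ℝ → ℝ) : Prop where
  contDiff : ContDiff ℝ 2 u
  even : Function.Even u
  ode : ∀ r : ℝ, 0 < r →
    -deriv (deriv u) r - ((N : ℝ) - 1) / r * deriv u r = g r (u r)
  init : u 0 = α
  init_deriv : deriv u 0 = 0

/-- The profile has an unbounded sequence of zeros. -/
def IsOscillating (u : ℝ → ℝ) : Prop :=
  ∃ s : ℕ → ℝ, Filter.Tendsto s Filter.atTop Filter.atTop ∧ ∀ n, u (s n) = 0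

/-- The profile converges to zero at infinity. -/
def IsLocalized (u : ℝ → ℝ) : Prop := Filter.Tendsto u Filter.atTop (nhds 0)

/-- The conditions near infinity: there are `ε, σ, C > 0` and a function `k`, integrable near
infinity, with `|2G(r,z) - z g(r,z)| ≤ C z² |ln|z||^(-1-σ)` and `g_r(r,z) z ≥ -k(r) z²` for
`|z| ≤ ε`, `r ≥ 1/ε`. Both conditions become weaker as `ε` decreases; `ε < 1` keeps `ln|z| ≠ 0`.
At `z = 0` both sides of both inequalities are zero. -/
def AsymptoticConditions (g : ℝ → ℝ → ℝ) : Prop :=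
  ∃ (ε σ C : ℝ) (k : ℝ → ℝ), 0 < ε ∧ ε < 1 ∧ 0 < σ ∧ 0 < C ∧
    MeasureTheory.IntegrableOn k (Set.Ici ε⁻¹) ∧
    ∀ r z : ℝ, ε⁻¹ ≤ r → |z| ≤ ε →
      |2 * primitive (g r) z - z * g r z| ≤ C * z ^ 2 * |Real.log (abs z)| ^ (-1 - σ) ∧
      -k r * z ^ 2 ≤ partialR g r z * z

/-! With `d = N - 1` the equation is a damped oscillator `u'' + (d/r) u' + g(r,u) = 0` with energy
`E = u'²/2 + G(r,u)`. Damping and `g_r z ≤ 0` both make `E` nonincreasing. Hence `G(r,u(r)) ≤ G(0,α)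
≤ G_∞ ≤ G(r,·)` at both endpoints of `[-α_*, α^*]`, and `u` cannot leave this interval
(`mem_range`). So `g` may be truncated outside it, and for a bounded continuous nonlinearity a
global solution comes from a Peano argument (`exists_radialOp_fixedPoint`).

Oscillation: where `u ≠ 0`, the angle `arctan (u'/u)` falls at a uniform rate for large `r`, which
cannot last (`exists_zero_ge`).

Decay: the damping dissipates only `u'²`. Adding the cross term `(d/2r) u u'` gives an energy `V`,
comparable to `u² + u'²` for large `r`, that loses both terms; this yields some power decay
(`exists_rpow_decay`). At the sharp rate, `V' + (d/r) V` consists of `(d/2r)(2G - u g)`, a term of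
size `r⁻² V`, and `G_r`. Power decay turns `|ln|u||^(-1-σ)` into `(ln r)^(-1-σ)`, so the first two
are integrable multiples of `V`, while `k` bounds the third from below; `V r^d` then stays between
positive constants (`exists_sharp_decay`).

Since `g_r` is not controlled jointly in `(r,z)`, `G` is never differentiated in `r`. At each radius
`x` the nonlinearity is frozen at `x`, and monotonicity follows from comparison just to the right of
`x` (`antitoneOn_of_eventually_le_right`). -/

open Set Filter Topology MeasureTheory

/-! ### Radial means: the equation without its singularity at the origin -/

/-- The weighted mean `∫₀¹ sⁿ F(rs) ds`; for `r ≠ 0` it is `r⁻ⁿ⁻¹ ∫₀ʳ tⁿ F(t) dt`. -/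
noncomputable def radialMean (n : ℕ) (F : ℝ → ℝ) (r : ℝ) : ℝ :=
  ∫ s in (0 : ℝ)..1, s ^ n * F (r * s)

theorem continuous_radialMean (n : ℕ) {F : ℝ → ℝ} (hF : Continuous F) :
    Continuous (radialMean n F) := by
  unfold radialMean
  refine intervalIntegral.continuous_parametric_intervalIntegral_of_continuous' ?_ 0 1
  simp only [Function.uncurry_def]
  fun_prop

theorem abs_radialMean_le (n : ℕ) {F : ℝ → ℝ} {M : ℝ} (hM : ∀ t, |F t| ≤ M) (r : ℝ) :
    |radialMean n F r| ≤ M := by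
  have h := intervalIntegral.norm_integral_le_of_norm_le_const
    (a := (0 : ℝ)) (b := 1) (f := fun s => s ^ n * F (r * s)) (C := M) ?_
  · simpa [radialMean] using h
  · intro s hs
    rw [uIoc_of_le zero_le_one] at hs
    have h1 : |s ^ n| ≤ 1 := by
      rw [abs_of_nonneg (pow_nonneg hs.1.le n)]
      exact pow_le_one₀ hs.1.le hs.2
    have h0 := abs_nonneg (F (r * s))
    rw [Real.norm_eq_abs, abs_mul]
    nlinarith [hM (r * s)]

theorem pow_mul_radialMean (n : ℕ) (F : ℝ → ℝ) (r : ℝ) :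
    r ^ (n + 1) * radialMean n F r = ∫ t in (0 : ℝ)..r, t ^ n * F t := by
  have h := intervalIntegral.smul_integral_comp_mul_left (a := 0) (b := 1)
    (f := fun t => t ^ n * F t) r
  simp only [mul_zero, mul_one, smul_eq_mul] at h
  rw [← h, radialMean, pow_succ', mul_assoc, ← intervalIntegral.integral_const_mul]
  congr 1
  refine intervalIntegral.integral_congr fun s _ => ?_
  simp only [mul_pow]
  ring

theorem radialMean_zero (n : ℕ) (F : ℝ → ℝ) : ((n : ℝ) + 1) * radialMean n F 0 = F 0 := by
  simp only [radialMean, zero_mul, intervalIntegral.integral_mul_const, integral_pow]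
  field_simp
  simp

/-- For `r ≠ 0` this is the quotient rule for `r⁻ⁿ ∫₀ʳ tⁿ F`; at `0` the slope is the mean itself.
The derivative is continuous across `0`, which makes solutions `C²` there. -/
theorem hasDerivAt_mul_radialMean (n : ℕ) {F : ℝ → ℝ} (hF : Continuous F) (r : ℝ) :
    HasDerivAt (fun r => r * radialMean n F r) (F r - n * radialMean n F r) r := by
  rcases eq_or_ne r 0 with rfl | hr
  · have h0 : F 0 - n * radialMean n F 0 = radialMean n F 0 := by
      linarith [radialMean_zero n F]
    rw [h0, hasDerivAt_iff_tendsto_slope]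
    refine Tendsto.congr' ?_ ((continuous_radialMean n hF).tendsto 0 |>.mono_left inf_le_left)
    filter_upwards [self_mem_nhdsWithin] with x hx
    have : x ≠ 0 := hx
    simp [slope_def_field, this]
  · have hP : HasDerivAt (fun x => ∫ t in (0 : ℝ)..x, t ^ n * F t) (r ^ n * F r) r := by
      have hc : Continuous fun t : ℝ => t ^ n * F t := by fun_prop
      exact intervalIntegral.integral_hasDerivAt_right (hc.intervalIntegrable _ _)
        (hc.stronglyMeasurableAtFilter _ _) hc.continuousAt
    have hq := hP.div (hasDerivAt_pow n r) (pow_ne_zero n hr)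
    have hev : (fun x => x * radialMean n F x) =ᶠ[𝓝 r]
        fun x => (∫ t in (0 : ℝ)..x, t ^ n * F t) / x ^ n := by
      filter_upwards [isOpen_ne.mem_nhds hr] with x hx
      have hx : x ≠ 0 := hx
      rw [← pow_mul_radialMean]
      field_simp
      ring
    refine (hq.congr_of_eventuallyEq hev).congr_deriv ?_
    rw [← pow_mul_radialMean]
    rcases n with _ | n
    · simp
    · simp only [Nat.add_sub_cancel]
      field_simp
      ring

/-! ### Monotonicity from one-sided local comparison -/

/-- A continuous function that is locally nonincreasing to the right of each point is
nonincreasing. -/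
theorem antitoneOn_of_eventually_le_right {W : ℝ → ℝ} {a : ℝ} (hW : ContinuousOn W (Ici a))
    (h : ∀ x, a ≤ x → ∀ᶠ y in 𝓝[>] x, W y ≤ W x) : AntitoneOn W (Ici a) := by
  intro p hp q hq hpq
  have hp : a ≤ p := hp
  have hcl : IsClosed ({y | W y ≤ W p} ∩ Icc p q) := by
    have hc : ContinuousOn W (Icc p q) := hW.mono fun y hy => hp.trans hy.1
    rw [inter_comm]
    exact hc.preimage_isClosed_of_isClosed isClosed_Icc isClosed_Iic
  -- Continuous induction: the set where `W ≤ W p` is closed in `[p, q]`, contains `p`, and extends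
  -- to the right of each of its points.
  refine hcl.Icc_subset_of_forall_exists_gt (le_refl (W p)) ?_ (right_mem_Icc.2 hpq)
  intro x hx y hy
  have hy : x < y := hy
  obtain ⟨z, hz, hz'⟩ := ((h x (hp.trans hx.2.1)).and (Ioc_mem_nhdsGT hy)).exists
  exact ⟨z, hz.trans hx.1, hz'⟩

theorem HasDerivAt.eventually_le_right {φ : ℝ → ℝ} {d x : ℝ} (h : HasDerivAt φ d x) (hd : d < 0) :
    ∀ᶠ y in 𝓝[>] x, φ y ≤ φ x := by
  have h1 := (hasDerivAt_iff_tendsto_slope.1 h).eventually (gt_mem_nhds hd)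
  have h2 : ∀ᶠ y in 𝓝[>] x, slope φ x y < 0 := h1.filter_mono (nhdsWithin_mono x fun y hy => ne_of_gt hy)
  filter_upwards [h2, self_mem_nhdsWithin] with y hy hxy
  have hxy : x < y := hxy
  rw [slope_def_field, div_neg_iff] at hy
  rcases hy with hy | hy <;> linarith

theorem HasDerivAt.eventually_ge_right {φ : ℝ → ℝ} {d x : ℝ} (h : HasDerivAt φ d x) (hd : 0 < d) :
    ∀ᶠ y in 𝓝[>] x, φ x ≤ φ y := by
  filter_upwards [h.neg.eventually_le_right (neg_neg_of_pos hd)] with y hy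
  simpa using hy

/-- A function whose local decrease is controlled by the increments of a continuous monotone
function decreases at most exponentially in that function. -/
theorem monotoneOn_mul_exp_of_eventually_ge_right {W K : ℝ → ℝ} {a A : ℝ} (hA : 0 ≤ A)
    (hW : ContinuousOn W (Ici a)) (hK : Continuous K) (hKm : Monotone K)
    (hpos : ∀ x, a ≤ x → 0 ≤ W x)
    (h : ∀ x, a ≤ x → ∀ᶠ y in 𝓝[>] x, W x * (1 - A * (K y - K x)) ≤ W y) :
    MonotoneOn (fun x => W x * Real.exp (2 * A * K x)) (Ici a) := by
  have key : AntitoneOn (fun x => -(W x * Real.exp (2 * A * K x))) (Ici a) := by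
    refine antitoneOn_of_eventually_le_right ?_ fun x hx => ?_
    · exact (hW.mul (by fun_prop)).neg
    · have hsmall : ∀ᶠ y in 𝓝[>] x, A * (K y - K x) < 1 / 2 := by
        have hc : ContinuousAt (fun y => A * (K y - K x)) x := by fun_prop
        have : Tendsto (fun y => A * (K y - K x)) (𝓝 x) (𝓝 0) := by
          simpa [ContinuousAt] using hc
        exact (this.eventually (gt_mem_nhds (by norm_num))).filter_mono inf_le_left
      filter_upwards [h x hx, hsmall, self_mem_nhdsWithin] with y hy hys hxy
      have hxy : x < y := hxy
      have hD : 0 ≤ A * (K y - K x) := mul_nonneg hA (sub_nonneg.2 (hKm hxy.le))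
      set D := A * (K y - K x) with hDdef
      -- For `0 ≤ D ≤ 1/2`, `(1 - D)(1 + 2D) = 1 + D(1 - 2D) ≥ 1`; hence the factor 2 in the
      -- exponent.
      have hexp : 1 ≤ (1 - D) * Real.exp (2 * D) := by
        nlinarith [Real.add_one_le_exp (2 * D)]
      have hsplit : Real.exp (2 * A * K y) = Real.exp (2 * A * K x) * Real.exp (2 * D) := by
        rw [← Real.exp_add, hDdef]
        ring_nf
      have e0 := Real.exp_pos (2 * A * K x)
      have e1 := Real.exp_pos (2 * D)
      have hWx := hpos x hx
      rw [neg_le_neg_iff, hsplit]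
      calc W x * Real.exp (2 * A * K x)
          ≤ W x * Real.exp (2 * A * K x) * ((1 - D) * Real.exp (2 * D)) :=
            le_mul_of_one_le_right (by positivity) hexp
        _ = W x * (1 - D) * (Real.exp (2 * A * K x) * Real.exp (2 * D)) := by ring
        _ ≤ W y * (Real.exp (2 * A * K x) * Real.exp (2 * D)) := by gcongr
  intro x hx y hy hxy
  exact neg_le_neg_iff.1 (key hx hy hxy)

/-! ### Primitives in the state variable -/

theorem primitive_nonneg {f : ℝ → ℝ} {z : ℝ} (h : ∀ t ∈ uIcc 0 z, 0 ≤ f t * t) :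
    0 ≤ primitive f z := by
  unfold primitive
  rcases le_total 0 z with hz | hz
  · rw [uIcc_of_le hz] at h
    rw [intervalIntegral.integral_of_le hz]
    refine setIntegral_nonneg measurableSet_Ioc fun t ht => ?_
    have := h t ⟨ht.1.le, ht.2⟩
    exact nonneg_of_mul_nonneg_left this ht.1
  · rw [uIcc_of_ge hz] at h
    -- The endpoint `t = 0`, where the hypothesis says nothing about `f t`, is discarded.
    rw [intervalIntegral.integral_symm, intervalIntegral.integral_of_le hz,
      integral_Ioc_eq_integral_Ioo, neg_nonneg]
    refine setIntegral_nonpos measurableSet_Ioo fun t ht => ?_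
    have := h t ⟨ht.1.le, ht.2.le⟩
    nlinarith [ht.2]

theorem primitive_mono {f h : ℝ → ℝ} {z : ℝ} (hf : Continuous f) (hh : Continuous h)
    (hfh : ∀ t ∈ uIcc 0 z, f t * t ≤ h t * t) : primitive f z ≤ primitive h z := by
  have h1 : primitive h z - primitive f z = primitive (fun t => h t - f t) z :=
    (intervalIntegral.integral_sub (hh.intervalIntegrable _ _) (hf.intervalIntegrable _ _)).symm
  have h2 : 0 ≤ primitive (fun t => h t - f t) z :=
    primitive_nonneg fun t ht => by linarith [hfh t ht, sub_mul (h t) (f t) t]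
  linarith

theorem primitive_linear (c z : ℝ) : primitive (fun t => c * t) z = c / 2 * z ^ 2 := by
  have h : primitive (fun t => c * t) z = c * ∫ t in (0 : ℝ)..z, t :=
    intervalIntegral.integral_const_mul c fun t => t
  rw [h, integral_id]
  ring

theorem hasDerivAt_primitive {f : ℝ → ℝ} (hf : Continuous f) (z : ℝ) :
    HasDerivAt (primitive f) (f z) z :=
  intervalIntegral.integral_hasDerivAt_right (hf.intervalIntegrable _ _)
    (hf.stronglyMeasurableAtFilter _ _) hf.continuousAt

theorem primitive_congr {f h : ℝ → ℝ} {z : ℝ} (hfh : EqOn f h (uIcc 0 z)) :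
    primitive f z = primitive h z :=
  intervalIntegral.integral_congr hfh

/-! ### Global existence for bounded continuous nonlinearities -/

/-- The integral operator whose fixed points are the even solutions of
`-u'' - (n/r) u' = f(|r|, u)`, `u(0) = α`, `u'(0) = 0`. -/
noncomputable def radialOp (n : ℕ) (f : ℝ → ℝ → ℝ) (α : ℝ) (u : ℝ → ℝ) (r : ℝ) : ℝ :=
  α - ∫ ρ in (0 : ℝ)..r, ρ * radialMean n (fun t => f |t| (u |t|)) ρ

section RadialOp

variable {n : ℕ} {f : ℝ → ℝ → ℝ} {α M : ℝ} {u : ℝ → ℝ}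

theorem continuous_nemytskii (hf : Continuous (Function.uncurry f)) (hu : Continuous u) :
    Continuous fun t : ℝ => f |t| (u |t|) :=
  hf.comp (continuous_abs.prodMk (hu.comp continuous_abs))

theorem hasDerivAt_radialOp (hf : Continuous (Function.uncurry f)) (hu : Continuous u) (r : ℝ) :
    HasDerivAt (radialOp n f α u) (-(r * radialMean n (fun t => f |t| (u |t|)) r)) r := by
  have hc : Continuous fun ρ => ρ * radialMean n (fun t => f |t| (u |t|)) ρ :=
    continuous_id.mul (continuous_radialMean n (continuous_nemytskii hf hu))
  exact (intervalIntegral.integral_hasDerivAt_right (hc.intervalIntegrable _ _)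
    (hc.stronglyMeasurableAtFilter _ _) hc.continuousAt).const_sub α

theorem continuous_radialOp (hf : Continuous (Function.uncurry f)) (hu : Continuous u) :
    Continuous (radialOp n f α u) :=
  continuous_iff_continuousAt.2 fun r => (hasDerivAt_radialOp hf hu r).continuousAt

theorem radialOp_zero : radialOp n f α u 0 = α := by simp [radialOp]

/-- The derivative at `r` is at most `M |r|` whatever `u` is; this uniform modulus supplies the
equicontinuity for Arzelà–Ascoli. -/
theorem abs_radialOp_sub_le (hf : Continuous (Function.uncurry f)) (hu : Continuous u)
    (hM : ∀ r z, |f r z| ≤ M) (x y : ℝ) :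
    |radialOp n f α u x - radialOp n f α u y| ≤ M * (|x| + |y|) * |x - y| := by
  have hM0 : 0 ≤ M := (abs_nonneg _).trans (hM 0 0)
  have hb : ∀ z ∈ uIcc x y,
      ‖-(z * radialMean n (fun t => f |t| (u |t|)) z)‖ ≤ M * (|x| + |y|) := by
    intro z hz
    have hz' : |z| ≤ |x| + |y| := by
      rcases mem_uIcc.1 hz with h | h <;> apply abs_le.2 <;> constructor <;>
        linarith [neg_abs_le x, le_abs_self x, neg_abs_le y, le_abs_self y, abs_nonneg x,
          abs_nonneg y]
    rw [norm_neg, Real.norm_eq_abs, abs_mul, mul_comm]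
    gcongr
    exact abs_radialMean_le n (fun t => hM _ _) z
  have h := (convex_uIcc x y).norm_image_sub_le_of_norm_hasDerivWithin_le
    (fun z _ => (hasDerivAt_radialOp (n := n) (α := α) hf hu z).hasDerivWithinAt) hb
    right_mem_uIcc left_mem_uIcc
  simpa [Real.norm_eq_abs] using h

/-- Causality: only the past of `r` enters, which is what makes the delayed iteration stabilise. -/
theorem radialOp_congr {v : ℝ → ℝ} {r : ℝ} (hr : 0 ≤ r) (huv : EqOn u v (Icc 0 r)) :
    radialOp n f α u r = radialOp n f α v r := by
  unfold radialOp
  congr 1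
  refine intervalIntegral.integral_congr fun ρ hρ => ?_
  rw [uIcc_of_le hr] at hρ
  have : radialMean n (fun t => f |t| (u |t|)) ρ = radialMean n (fun t => f |t| (v |t|)) ρ := by
    refine intervalIntegral.integral_congr fun s hs => ?_
    rw [uIcc_of_le zero_le_one] at hs
    have hmem : |ρ * s| ∈ Icc 0 r := by
      refine ⟨abs_nonneg _, ?_⟩
      rw [abs_of_nonneg (mul_nonneg hρ.1 hs.1)]
      exact (mul_le_of_le_one_right hρ.1 hs.2).trans hρ.2
    simp only [huv hmem]
  simp only [this]

theorem radialOp_neg (r : ℝ) : radialOp n f α u (-r) = radialOp n f α u r := by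
  have hmean : ∀ ρ, radialMean n (fun t => f |t| (u |t|)) (-ρ) =
      radialMean n (fun t => f |t| (u |t|)) ρ := fun ρ => by simp [radialMean]
  have h := intervalIntegral.integral_comp_neg (a := 0) (b := r)
    (fun ρ => ρ * radialMean n (fun t => f |t| (u |t|)) ρ)
  simp only [hmean, neg_zero, neg_mul, intervalIntegral.integral_neg] at h
  rw [radialOp, radialOp, intervalIntegral.integral_symm, ← h, neg_neg]

theorem tendsto_radialOp {v : ℕ → ℝ → ℝ} (hf : Continuous (Function.uncurry f))
    (hM : ∀ r z, |f r z| ≤ M) (hv : ∀ k, Continuous (v k))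
    (hlim : ∀ r, Tendsto (fun k => v k r) atTop (𝓝 (u r))) (r : ℝ) :
    Tendsto (fun k => radialOp n f α (v k) r) atTop (𝓝 (radialOp n f α u r)) := by
  have hfl : ∀ t, Tendsto (fun k => f |t| (v k |t|)) atTop (𝓝 (f |t| (u |t|))) := fun t =>
    (hf.tendsto (|t|, u |t|)).comp (tendsto_const_nhds.prodMk_nhds (hlim |t|))
  have hmean : ∀ ρ, Tendsto (fun k => radialMean n (fun t => f |t| (v k |t|)) ρ) atTop
      (𝓝 (radialMean n (fun t => f |t| (u |t|)) ρ)) := by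
    intro ρ
    refine intervalIntegral.tendsto_integral_filter_of_dominated_convergence (fun _ => M)
      (Eventually.of_forall fun k => ?_) (Eventually.of_forall fun k => ?_)
      intervalIntegrable_const ?_
    · have := continuous_nemytskii hf (hv k)
      exact Continuous.aestronglyMeasurable (by fun_prop)
    · refine Eventually.of_forall fun s hs => ?_
      rw [uIoc_of_le zero_le_one] at hs
      have h1 : |s ^ n| ≤ 1 := by
        rw [abs_of_nonneg (pow_nonneg hs.1.le n)]
        exact pow_le_one₀ hs.1.le hs.2
      rw [Real.norm_eq_abs, abs_mul]
      nlinarith [hM |ρ * s| (v k |ρ * s|), abs_nonneg (f |ρ * s| (v k |ρ * s|))]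
    · exact Eventually.of_forall fun s _ => (hfl (ρ * s)).const_mul _
  refine Tendsto.const_sub α ?_
  refine intervalIntegral.tendsto_integral_filter_of_dominated_convergence (fun ρ => |ρ| * M)
      (Eventually.of_forall fun k => ?_) (Eventually.of_forall fun k => ?_) ?_ ?_
  · have := continuous_radialMean n (continuous_nemytskii hf (hv k))
    exact Continuous.aestronglyMeasurable (by fun_prop)
  · refine Eventually.of_forall fun ρ _ => ?_
    rw [Real.norm_eq_abs, abs_mul]
    gcongr
    exact abs_radialMean_le n (fun t => hM _ _) ρ
  · exact Continuous.intervalIntegrable (by fun_prop) _ _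
  · exact Eventually.of_forall fun ρ _ => (hmean ρ).const_mul ρ

/-- Functions through `(0, α)` with at most quadratic growth of the increments. -/
def quadraticLipschitzSet (α M : ℝ) : Set C(ℝ, ℝ) :=
  {u | u 0 = α ∧ ∀ x y, |u x - u y| ≤ M * (|x| + |y|) * |x - y|}

theorem isCompact_quadraticLipschitzSet (α M : ℝ) :
    IsCompact (quadraticLipschitzSet α M) := by
  refine ArzelaAscoli.isCompact_of_equicontinuous _ ?_ ?_
  · have himg : ContinuousMap.toFun '' quadraticLipschitzSet α M =
        {u : ℝ → ℝ | u 0 = α ∧ ∀ x y, |u x - u y| ≤ M * (|x| + |y|) * |x - y|} := by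
      ext w
      constructor
      · rintro ⟨u, hu, rfl⟩
        exact hu
      · intro hw
        have hc : Continuous w := by
          refine continuous_iff_continuousAt.2 fun x => ?_
          refine tendsto_iff_dist_tendsto_zero.2 ?_
          have hlim : Tendsto (fun y => M * (|y| + |x|) * |y - x|) (𝓝 x) (𝓝 0) := by
            have : ContinuousAt (fun y => M * (|y| + |x|) * |y - x|) x := by fun_prop
            simpa [ContinuousAt] using this
          exact squeeze_zero (fun _ => dist_nonneg) (fun y => hw.2 y x) hlim
        exact ⟨⟨w, hc⟩, hw, rfl⟩
    rw [himg]
    refine (isCompact_univ_pi fun x : ℝ =>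
      isCompact_Icc (a := α - M * |x| * |x|) (b := α + M * |x| * |x|)).of_isClosed_subset ?_ ?_
    · simp only [ofPred_and, ofPred_forall]
      refine (isClosed_eq (by fun_prop) (by fun_prop)).inter ?_
      exact isClosed_iInter fun x => isClosed_iInter fun y => isClosed_le (by fun_prop) (by fun_prop)
    · rintro w ⟨h0, hw⟩ x -
      have := abs_le.1 (hw x 0)
      simp only [h0, abs_zero, add_zero, sub_zero] at this
      constructor <;> linarith [this.1, this.2]
  · intro x
    rw [Metric.equicontinuousAt_iff_right]
    intro ε hε
    have hlim : Tendsto (fun y => M * (|x| + |y|) * |x - y|) (𝓝 x) (𝓝 0) := by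
      have : ContinuousAt (fun y => M * (|x| + |y|) * |x - y|) x := by fun_prop
      simpa [ContinuousAt] using this
    filter_upwards [hlim.eventually (gt_mem_nhds hε)] with y hy w
    exact (w.2.2 x y).trans_lt hy

/-- The delayed operator `u ↦ (r ↦ T u (max (r - δ) 0))`. -/
noncomputable def delayedOp (n : ℕ) {f : ℝ → ℝ → ℝ} (hf : Continuous (Function.uncurry f))
    (α δ : ℝ) (u : C(ℝ, ℝ)) : C(ℝ, ℝ) :=
  ⟨fun r => radialOp n f α u (max (r - δ) 0),
    (continuous_radialOp hf u.continuous).comp (by fun_prop)⟩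

theorem delayedOp_mem (hf : Continuous (Function.uncurry f)) (hM : ∀ r z, |f r z| ≤ M)
    {δ : ℝ} (hδ : 0 ≤ δ) (w : C(ℝ, ℝ)) : delayedOp n hf α δ w ∈ quadraticLipschitzSet α M := by
  have hM0 : 0 ≤ M := (abs_nonneg _).trans (hM 0 0)
  constructor
  · have : max (0 - δ) 0 = 0 := max_eq_right (by linarith)
    simp only [delayedOp, ContinuousMap.coe_mk, this, radialOp_zero]
  · intro x y
    refine (abs_radialOp_sub_le hf w.continuous hM _ _).trans ?_
    have habs : ∀ z : ℝ, |max (z - δ) 0| ≤ |z| := fun z => by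
      rw [abs_of_nonneg (le_max_right _ _)]
      exact max_le (by linarith [le_abs_self z]) (abs_nonneg z)
    have h3 : |max (x - δ) 0 - max (y - δ) 0| ≤ |x - y| := by
      refine (abs_max_sub_max_le_abs _ _ _).trans (le_of_eq ?_)
      ring_nf
    exact mul_le_mul (mul_le_mul_of_nonneg_left (add_le_add (habs x) (habs y)) hM0) h3
      (abs_nonneg _) (by positivity)

/-- All iterates equal `α` on `r ≤ 0`, and by causality each further application extends the
agreement by one delay `δ`. -/
theorem delayedOp_iterate_eq (hf : Continuous (Function.uncurry f)) {δ : ℝ} (hδ : 0 ≤ δ)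
    (w : C(ℝ, ℝ)) (hw : w = ContinuousMap.const ℝ α) (j : ℕ) :
    EqOn ((delayedOp n hf α δ)^[j + 1] w) ((delayedOp n hf α δ)^[j] w) (Iic (j * δ)) := by
  induction j with
  | zero =>
    intro r hr
    have hr' : r ≤ 0 := by simpa using hr
    have : max (r - δ) 0 = 0 := max_eq_right (by linarith)
    simp [delayedOp, this, radialOp_zero, hw]
  | succ j ih =>
    intro r hr
    rw [Function.iterate_succ_apply'] at ih
    rw [Function.iterate_succ_apply', Function.iterate_succ_apply' _ j]
    refine radialOp_congr (le_max_right _ _) fun t ht => ih (ht.2.trans ?_)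
    have hr : r ≤ (j + 1 : ℕ) * δ := hr
    push_cast at hr
    exact max_le (by linarith) (by positivity)

/-- Tonelli's form of Peano's theorem: `f` is only continuous, so there is no contraction. Exact
solutions of delayed problems are compact, and a limit as the delay tends to `0` solves the
undelayed one. -/
theorem exists_radialOp_fixedPoint (n : ℕ) (hf : Continuous (Function.uncurry f))
    (hM : ∀ r z, |f r z| ≤ M) (α : ℝ) :
    ∃ v : ℝ → ℝ, Continuous v ∧ ∀ r, 0 ≤ r → v r = radialOp n f α v r := by
  have hM0 : 0 ≤ M := (abs_nonneg _).trans (hM 0 0)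
  let δ : ℕ → ℝ := fun k => 1 / ((k : ℝ) + 1)
  have hδ0 : ∀ k, 0 ≤ δ k := fun k => by positivity
  -- With delay `1/(k+1)`, `k(k+1)` iterations give a delayed fixed point on `r ≤ k`.
  let w : ℕ → C(ℝ, ℝ) := fun k =>
    (delayedOp n hf α (δ k))^[k * (k + 1)] (ContinuousMap.const ℝ α)
  have hwS : ∀ k, w k ∈ quadraticLipschitzSet α M := by
    intro k
    by_cases hk : k * (k + 1) = 0
    · simp only [w, hk, Function.iterate_zero, id]
      refine ⟨rfl, fun x y => ?_⟩
      simp only [ContinuousMap.const_apply, sub_self, abs_zero]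
      positivity
    · obtain ⟨m, hm⟩ := Nat.exists_eq_succ_of_ne_zero hk
      simp only [w, hm, Nat.succ_eq_add_one, Function.iterate_succ_apply']
      exact delayedOp_mem hf hM (hδ0 k) _
  have hfix : ∀ k : ℕ, ∀ r : ℝ, r ≤ k → w k r = radialOp n f α (w k) (max (r - δ k) 0) := by
    intro k r hr
    have h := delayedOp_iterate_eq (n := n) (α := α) hf (hδ0 k) _ rfl (k * (k + 1))
      (x := r) (by
        simp only [mem_Iic, δ]
        push_cast
        field_simp
        exact hr)
    rw [Function.iterate_succ_apply'] at h
    exact h.symm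
  obtain ⟨v, -, φ, hφ, hlim⟩ := (isCompact_quadraticLipschitzSet α M).tendsto_subseq hwS
  have hpt : ∀ r, Tendsto (fun k => w (φ k) r) atTop (𝓝 (v r)) := fun r =>
    ((ContinuousEvalConst.continuous_eval_const r).tendsto v).comp hlim
  refine ⟨v, v.continuous, fun r hr => tendsto_nhds_unique (hpt r) ?_⟩
  have hT := tendsto_radialOp (n := n) (α := α) hf hM (fun k => (w (φ k)).continuous) hpt r
  have hδlim : Tendsto (fun k => M * (|r| + |r|) * δ (φ k)) atTop (𝓝 0) := by
    have h := (tendsto_one_div_add_atTop_nhds_zero_nat (𝕜 := ℝ)).comp hφ.tendsto_atTop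
    simpa [δ, Function.comp_def] using h.const_mul (M * (|r| + |r|))
  have hdiff : Tendsto (fun k => w (φ k) r - radialOp n f α (w (φ k)) r) atTop (𝓝 0) := by
    refine squeeze_zero_norm' ?_ hδlim
    have hbig : ∀ᶠ k in atTop, r ≤ (φ k : ℝ) :=
      (tendsto_natCast_atTop_atTop.comp hφ.tendsto_atTop).eventually_ge_atTop r
    filter_upwards [hbig] with k hk
    rw [hfix _ r hk, Real.norm_eq_abs]
    refine (abs_radialOp_sub_le hf (w (φ k)).continuous hM _ _).trans ?_
    have h1 : |max (r - δ (φ k)) 0| ≤ |r| := by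
      rw [abs_of_nonneg (le_max_right _ _)]
      exact max_le (by linarith [le_abs_self r, hδ0 (φ k)]) (abs_nonneg r)
    have h2 : |max (r - δ (φ k)) 0 - r| ≤ δ (φ k) := by
      rw [abs_le]
      constructor
      · linarith [le_max_left (r - δ (φ k)) 0]
      · have := hδ0 (φ k)
        have h2 : max (r - δ (φ k)) 0 ≤ r + δ (φ k) := max_le (by linarith) (by linarith)
        linarith
    gcongr
  simpa using hdiff.add hT

/-- The fixed point `v` is controlled only on `[0,∞)`. Its image under the operator agrees with `v`
there, and is even and `C²` on the whole line. -/
theorem exists_radial_profile (n : ℕ) (hf : Continuous (Function.uncurry f))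
    (hM : ∀ r z, |f r z| ≤ M) (α : ℝ) :
    ∃ u : ℝ → ℝ, ContDiff ℝ 2 u ∧ Function.Even u ∧ u 0 = α ∧ deriv u 0 = 0 ∧
      ∀ r, 0 < r → -deriv (deriv u) r - n / r * deriv u r = f r (u r) := by
  obtain ⟨v, hv, hfix⟩ := exists_radialOp_fixedPoint n hf hM α
  have hF := continuous_nemytskii hf hv
  set F : ℝ → ℝ := fun t => f |t| (v |t|) with hFdef
  have hderiv : deriv (radialOp n f α v) = fun r => -(r * radialMean n F r) :=
    funext fun r => (hasDerivAt_radialOp hf hv r).deriv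
  have hderiv2 : ∀ r, HasDerivAt (deriv (radialOp n f α v)) (-(F r - n * radialMean n F r)) r := by
    intro r
    rw [hderiv]
    exact (hasDerivAt_mul_radialMean n hF r).neg
  refine ⟨radialOp n f α v, ?_, radialOp_neg, radialOp_zero, ?_, fun r hr => ?_⟩
  · rw [show (2 : WithTop ℕ∞) = 1 + 1 from rfl, contDiff_succ_iff_deriv]
    refine ⟨fun r => (hasDerivAt_radialOp hf hv r).differentiableAt, by simp, ?_⟩
    rw [contDiff_one_iff_deriv]
    refine ⟨fun r => (hderiv2 r).differentiableAt, ?_⟩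
    rw [funext fun r => (hderiv2 r).deriv]
    have := continuous_radialMean n hF
    fun_prop
  · simp [hderiv]
  · rw [(hderiv2 r).deriv, hderiv, ← hfix r hr.le]
    simp only [hFdef, abs_of_pos hr]
    field_simp
    ring

end RadialOp

/-! ### Energies of damped profiles -/

/-- A solution of the damped equation `-u'' - (d/r) u' = f(r,u)` on `(0,∞)` with `u'(0) = 0`,
where `f(r,z) z` is nonnegative and nonincreasing in `r`. -/
structure IsDampedProfile (d : ℝ) (f : ℝ → ℝ → ℝ) (u : ℝ → ℝ) : Prop where
  damping_pos : 0 < d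
  continuous_uncurry : Continuous (Function.uncurry f)
  mul_antitone : ∀ r s z : ℝ, 0 ≤ r → r ≤ s → f s z * z ≤ f r z * z
  mul_nonneg : ∀ r z : ℝ, 0 ≤ r → 0 ≤ f r z * z
  contDiff : ContDiff ℝ 2 u
  deriv_zero : deriv u 0 = 0
  ode : ∀ r : ℝ, 0 < r → -deriv (deriv u) r - d / r * deriv u r = f r (u r)

/-- The energy `u'²/2 + F(r,u)`, with `F` the primitive of `f` in the second variable. -/
noncomputable def energy (f : ℝ → ℝ → ℝ) (u : ℝ → ℝ) (r : ℝ) : ℝ :=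
  deriv u r ^ 2 / 2 + primitive (f r) (u r)

/-- The energy corrected by the cross term `(d/2r) u u'`. -/
noncomputable def modifiedEnergy (d : ℝ) (f : ℝ → ℝ → ℝ) (u : ℝ → ℝ) (r : ℝ) : ℝ :=
  energy f u r + d / (2 * r) * (u r * deriv u r)

/-- The modified energy at `y` with the nonlinearity frozen at `x`. -/
noncomputable def frozenEnergy (d : ℝ) (f : ℝ → ℝ → ℝ) (u : ℝ → ℝ) (x y : ℝ) : ℝ :=
  deriv u y ^ 2 / 2 + primitive (f x) (u y) + d / (2 * y) * (u y * deriv u y)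

theorem eq_zero_of_mul_nonneg {h : ℝ → ℝ} (hc : Continuous h) (hs : ∀ z, 0 ≤ h z * z) :
    h 0 = 0 := by
  apply le_antisymm
  · refine le_of_tendsto (hc.continuousWithinAt (s := Iio 0) (x := 0)).tendsto ?_
    filter_upwards [self_mem_nhdsWithin] with z hz
    have hz : z < 0 := hz
    nlinarith [hs z]
  · refine ge_of_tendsto (hc.continuousWithinAt (s := Ioi 0) (x := 0)).tendsto ?_
    filter_upwards [self_mem_nhdsWithin] with z hz
    have hz : 0 < z := hz
    nlinarith [hs z]

namespace IsDampedProfile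

variable {d : ℝ} {f : ℝ → ℝ → ℝ} {u : ℝ → ℝ}

theorem continuous_right (h : IsDampedProfile d f u) (r : ℝ) : Continuous (f r) :=
  h.continuous_uncurry.comp (by fun_prop : Continuous fun z : ℝ => (r, z))

theorem hasDerivAt (h : IsDampedProfile d f u) (r : ℝ) : HasDerivAt u (deriv u r) r :=
  ((h.contDiff.differentiable (by norm_num)) r).hasDerivAt

theorem contDiff_deriv (h : IsDampedProfile d f u) : ContDiff ℝ 1 (deriv u) := by
  have := h.contDiff
  rw [show (2 : WithTop ℕ∞) = 1 + 1 from rfl, contDiff_succ_iff_deriv] at this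
  exact this.2.2

theorem hasDerivAt_deriv (h : IsDampedProfile d f u) (r : ℝ) :
    HasDerivAt (deriv u) (deriv (deriv u) r) r :=
  ((h.contDiff_deriv.differentiable (by norm_num)) r).hasDerivAt

theorem continuous (h : IsDampedProfile d f u) : Continuous u := h.contDiff.continuous

theorem continuous_deriv (h : IsDampedProfile d f u) : Continuous (deriv u) :=
  h.contDiff_deriv.continuous

theorem continuous_deriv_deriv (h : IsDampedProfile d f u) : Continuous (deriv (deriv u)) :=
  (contDiff_one_iff_deriv.1 h.contDiff_deriv).2

theorem deriv_deriv_eq (h : IsDampedProfile d f u) {r : ℝ} (hr : 0 < r) :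
    deriv (deriv u) r = -f r (u r) - d / r * deriv u r := by
  linarith [h.ode r hr]

theorem apply_zero (h : IsDampedProfile d f u) {r : ℝ} (hr : 0 ≤ r) : f r 0 = 0 :=
  eq_zero_of_mul_nonneg (h.continuous_right r) fun z => h.mul_nonneg r z hr

theorem primitive_nonneg (h : IsDampedProfile d f u) {r : ℝ} (hr : 0 ≤ r) (z : ℝ) :
    0 ≤ primitive (f r) z :=
  _root_.primitive_nonneg fun t _ => h.mul_nonneg r t hr

theorem primitive_antitone (h : IsDampedProfile d f u) {r s : ℝ} (hr : 0 ≤ r) (hrs : r ≤ s)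
    (z : ℝ) : primitive (f s) z ≤ primitive (f r) z :=
  primitive_mono (h.continuous_right s) (h.continuous_right r)
    fun t _ => h.mul_antitone r s t hr hrs

theorem continuous_energy (h : IsDampedProfile d f u) : Continuous (energy f u) := by
  have h1 : Continuous fun r => primitive (f r) (u r) :=
    intervalIntegral.continuous_parametric_intervalIntegral_of_continuous
      h.continuous_uncurry h.continuous
  have h2 := h.continuous_deriv
  unfold energy
  fun_prop

theorem continuousOn_modifiedEnergy (h : IsDampedProfile d f u) :
    ContinuousOn (modifiedEnergy d f u) (Ioi 0) := by
  have h1 := h.continuous_energy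
  have h2 := h.continuous_deriv
  have h3 := h.continuous
  unfold modifiedEnergy
  refine h1.continuousOn.add (ContinuousOn.mul ?_ (by fun_prop))
  exact ContinuousOn.div (by fun_prop) (by fun_prop) fun x hx => by
    have : 0 < x := hx
    positivity

theorem hasDerivAt_frozen (h : IsDampedProfile d f u) (x : ℝ) :
    HasDerivAt (fun y => deriv u y ^ 2 / 2 + primitive (f x) (u y))
      (deriv u x * (deriv (deriv u) x + f x (u x))) x := by
  have h1 := ((h.hasDerivAt_deriv x).pow 2).div_const 2
  have h2 := (hasDerivAt_primitive (h.continuous_right x) (u x)).comp x (h.hasDerivAt x)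
  refine (h1.add h2).congr_deriv ?_
  simp only [Nat.cast_ofNat]
  ring

theorem energy_antitoneOn (h : IsDampedProfile d f u) : AntitoneOn (energy f u) (Ici 0) := by
  -- The local criterion needs a strictly negative derivative, so `η x` is subtracted and `η → 0` at
  -- the end.
  have hη : ∀ η : ℝ, 0 < η → AntitoneOn (fun x => energy f u x - η * x) (Ici 0) := by
    intro η hη
    refine antitoneOn_of_eventually_le_right ?_ fun x hx => ?_
    · have := h.continuous_energy
      fun_prop
    · have hd : deriv u x * (deriv (deriv u) x + f x (u x)) ≤ 0 := by
        rcases hx.eq_or_lt with rfl | hx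
        -- The equation is not available at `x = 0`; there `u' = 0` suffices.
        · simp [h.deriv_zero]
        · rw [h.deriv_deriv_eq hx]
          have h1 : 0 ≤ d / x * deriv u x ^ 2 :=
            _root_.mul_nonneg (div_pos h.damping_pos hx).le (sq_nonneg _)
          linarith
      have hder := (h.hasDerivAt_frozen x).sub ((hasDerivAt_id x).const_mul η)
      filter_upwards [hder.eventually_le_right (by simp; linarith), self_mem_nhdsWithin]
        with y hy hxy
      have hxy : x < y := hxy
      -- The energy frozen at `x` dominates the true energy for `y > x` and equals it at `y = x`.
      have := h.primitive_antitone hx hxy.le (u y)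
      simp only [Pi.sub_apply, id] at hy
      simp only [energy]
      linarith
  intro x hx y hy hxy
  refine le_of_forall_pos_le_add fun ε hε => ?_
  have h1 := hη (ε / (y - x + 1)) (div_pos hε (by linarith)) hx hy hxy
  have h2 : ε / (y - x + 1) * (y - x) ≤ ε := by
    rw [div_mul_eq_mul_div, div_le_iff₀ (by linarith)]
    nlinarith
  simp only at h1
  linarith

theorem frozenEnergy_self (x : ℝ) : frozenEnergy d f u x x = modifiedEnergy d f u x := rfl

theorem modifiedEnergy_le_frozenEnergy (h : IsDampedProfile d f u) {x y : ℝ} (hx : 0 ≤ x)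
    (hxy : x ≤ y) : modifiedEnergy d f u y ≤ frozenEnergy d f u x y := by
  have := h.primitive_antitone hx hxy (u y)
  simp only [modifiedEnergy, frozenEnergy, energy]
  linarith

/-- The cross term trades half of the dissipation `(d/x) u'²` for `(d/2x) u f(x,u)`, so both
components of the phase vector are damped, up to a term of order `x⁻²`. -/
theorem hasDerivAt_frozenEnergy (h : IsDampedProfile d f u) {x : ℝ} (hx : 0 < x) :
    HasDerivAt (frozenEnergy d f u x)
      (-(d / (2 * x)) * (deriv u x ^ 2 + f x (u x) * u x)
        - d * (d + 1) / (2 * x ^ 2) * (u x * deriv u x)) x := by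
  have h1 : HasDerivAt (fun y : ℝ => d / (2 * y)) (-(d / (2 * x ^ 2))) x := by
    refine ((hasDerivAt_const x d).div ((hasDerivAt_id x).const_mul 2) (by simp; positivity)
      ).congr_deriv ?_
    simp only [id]
    field_simp
    ring
  refine ((h.hasDerivAt_frozen x).add
    (h1.mul ((h.hasDerivAt x).mul (h.hasDerivAt_deriv x)))).congr_deriv ?_
  simp only [Pi.mul_apply]
  rw [h.deriv_deriv_eq hx]
  field_simp
  ring

end IsDampedProfile

/-! ### Nonvanishing of the phase vector and oscillation -/

/-- A damped profile on whose range `f` has linear growth: `lam t² ≤ f(r,t) t ≤ Lam t²`. -/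
structure IsLinearlyBoundedProfile (d lam Lam : ℝ) (f : ℝ → ℝ → ℝ) (u : ℝ → ℝ) : Prop
    extends IsDampedProfile d f u where
  lower_pos : 0 < lam
  upper_pos : 0 < Lam
  growth : ∀ r : ℝ, 0 ≤ r → ∀ t ∈ uIcc 0 (u r),
    lam * t ^ 2 ≤ f r t * t ∧ f r t * t ≤ Lam * t ^ 2

namespace IsLinearlyBoundedProfile

variable {d lam Lam : ℝ} {f : ℝ → ℝ → ℝ} {u : ℝ → ℝ}

theorem abs_apply_le (h : IsLinearlyBoundedProfile d lam Lam f u) {r : ℝ} (hr : 0 ≤ r) :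
    |f r (u r)| ≤ Lam * |u r| := by
  rcases eq_or_ne (u r) 0 with hu | hu
  · rw [hu, h.apply_zero hr]
    simp
  · have h1 := (h.growth r hr (u r) right_mem_uIcc).2
    have h2 := h.mul_nonneg r (u r) hr
    have h3 : |f r (u r)| * |u r| ≤ Lam * |u r| * |u r| := by
      rw [← abs_mul, abs_of_nonneg h2, mul_assoc, abs_mul_abs_self]
      linarith [sq (u r)]
    exact le_of_mul_le_mul_right h3 (abs_pos.2 hu)

theorem primitive_bounds (h : IsLinearlyBoundedProfile d lam Lam f u) {r : ℝ} (hr : 0 ≤ r) :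
    lam / 2 * u r ^ 2 ≤ primitive (f r) (u r) ∧ primitive (f r) (u r) ≤ Lam / 2 * u r ^ 2 := by
  have hc := h.continuous_right r
  rw [← primitive_linear, ← primitive_linear]
  constructor
  · refine primitive_mono (by fun_prop) hc fun t ht => ?_
    linarith [(h.growth r hr t ht).1]
  · refine primitive_mono hc (by fun_prop) fun t ht => ?_
    linarith [(h.growth r hr t ht).2]

/-- The squared norm of the phase vector does not vanish unless it vanishes identically. -/
theorem sq_add_sq_pos (h : IsLinearlyBoundedProfile d lam Lam f u) {a : ℝ} (ha : 0 < a)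
    (hua : u a ≠ 0) {r : ℝ} (hr : a ≤ r) : 0 < u r ^ 2 + deriv u r ^ 2 := by
  have hd := h.damping_pos
  have hLam := h.upper_pos
  -- The three summands bound `2|u u'|`, `2|u' f|` and `2(d/x) u'²` by multiples of `u² + u'²` for
  -- `x ≥ a`. The monotonicity replaces backward uniqueness for the zero solution.
  set C : ℝ := 1 + Lam + 2 * d / a with hC
  have hmono : MonotoneOn (fun x => (u x ^ 2 + deriv u x ^ 2) * Real.exp (C * x)) (Ici a) := by
    have hder : ∀ x, HasDerivAt (fun x => (u x ^ 2 + deriv u x ^ 2) * Real.exp (C * x))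
        ((2 * u x * deriv u x + 2 * deriv u x * deriv (deriv u) x
          + C * (u x ^ 2 + deriv u x ^ 2)) * Real.exp (C * x)) x := by
      intro x
      have h1 := ((h.hasDerivAt x).pow 2).add ((h.hasDerivAt_deriv x).pow 2)
      have h2 := ((hasDerivAt_id x).const_mul C).exp
      refine (h1.mul h2).congr_deriv ?_
      simp only [Nat.cast_ofNat, Pi.add_apply, Pi.pow_apply, id]
      ring
    refine monotoneOn_of_deriv_nonneg (convex_Ici a)
      (fun x _ => (hder x).continuousAt.continuousWithinAt)
      (fun x _ => (hder x).differentiableAt.differentiableWithinAt) fun x hx => ?_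
    rw [interior_Ici] at hx
    have hx : a < x := hx
    have hx0 : 0 < x := ha.trans hx
    rw [(hder x).deriv, h.deriv_deriv_eq hx0]
    refine _root_.mul_nonneg ?_ (Real.exp_pos _).le
    have h3 : |deriv u x * f x (u x)| ≤ Lam * ((u x ^ 2 + deriv u x ^ 2) / 2) := by
      rw [abs_mul]
      have h4 := h.abs_apply_le hx0.le
      have h5 := abs_nonneg (deriv u x)
      nlinarith [sq_nonneg (|u x| - |deriv u x|), sq_abs (u x), sq_abs (deriv u x)]
    have h6 : d / x * deriv u x ^ 2 ≤ d / a * (u x ^ 2 + deriv u x ^ 2) := by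
      have : d / x ≤ d / a := by gcongr
      have h7 : 0 < d / a := by positivity
      nlinarith [sq_nonneg (u x), sq_nonneg (deriv u x)]
    have h8 : C * (u x ^ 2 + deriv u x ^ 2) = (u x ^ 2 + deriv u x ^ 2)
        + Lam * (u x ^ 2 + deriv u x ^ 2) + 2 * (d / a * (u x ^ 2 + deriv u x ^ 2)) := by
      rw [hC]
      ring
    nlinarith [sq_nonneg (u x + deriv u x), (abs_le.1 h3).2]
  have h1 := hmono (mem_Ici.2 le_rfl) (mem_Ici.2 hr) hr
  have h2 : 0 < (u a ^ 2 + deriv u a ^ 2) * Real.exp (C * a) := by positivity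
  exact pos_of_mul_pos_left (h2.trans_le h1) (Real.exp_pos _).le

/-- The profile has zeros arbitrarily far out. -/
theorem exists_zero_ge (h : IsLinearlyBoundedProfile d lam Lam f u) (R : ℝ) :
    ∃ r, R ≤ r ∧ u r = 0 := by
  by_contra! hne
  have hd := h.damping_pos
  have hlam := h.lower_pos
  set a : ℝ := max R (d ^ 2 / lam + d + 1) with ha
  have haR : R ≤ a := le_max_left _ _
  have ha1 : d ^ 2 / lam + d + 1 ≤ a := le_max_right _ _
  set c : ℝ := min 1 lam / 2 with hc
  have hc0 : 0 < c := by positivity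
  have hc1 : 2 * c ≤ 1 := by rw [hc]; linarith [min_le_left 1 lam]
  have hc2 : 2 * c ≤ lam := by rw [hc]; linarith [min_le_right 1 lam]
  -- Prüfer angle: without zeros, `p = u'/u` is global and `p' = -q - (d/x) p - p²` with `q = f/u ≥
  -- lam`.
  have hder : ∀ x, a ≤ x → HasDerivAt (fun x => Real.arctan (deriv u x / u x) + c * x)
      (1 / (1 + (deriv u x / u x) ^ 2) * ((deriv (deriv u) x * u x - deriv u x * deriv u x)
        / u x ^ 2) + c) x := by
    intro x hx
    have h1 := ((h.hasDerivAt_deriv x).div (h.hasDerivAt x) (hne x (haR.trans hx))).arctan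
    refine (h1.add ((hasDerivAt_id x).const_mul c)).congr_deriv ?_
    simp
  have hanti : AntitoneOn (fun x => Real.arctan (deriv u x / u x) + c * x) (Ici a) := by
    refine antitoneOn_of_deriv_nonpos (convex_Ici a)
      (fun x hx => (hder x hx).continuousAt.continuousWithinAt)
      (fun x hx => (hder x (interior_subset hx)).differentiableAt.differentiableWithinAt)
      fun x hx => ?_
    have hx : a ≤ x := interior_subset hx
    have hux := hne x (haR.trans hx)
    have hx1 : d ^ 2 / lam + d + 1 ≤ x := ha1.trans hx
    have hx0 : 0 < x := by
      have : 0 ≤ d ^ 2 / lam := by positivity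
      linarith
    rw [(hder x hx).deriv, h.deriv_deriv_eq hx0]
    set p := deriv u x / u x with hp
    have hdu : deriv u x = p * u x := by rw [hp]; field_simp
    set q := f x (u x) / u x with hq
    have hfq : f x (u x) = q * u x := by rw [hq]; field_simp
    have hqlam : lam ≤ q := by
      have h1 := (h.growth x hx0.le (u x) right_mem_uIcc).1
      rw [hfq] at h1
      have h2 : 0 < u x ^ 2 := by positivity
      exact le_of_mul_le_mul_right (by linarith [mul_assoc q (u x) (u x), sq (u x)]) h2
    have heq : ((-f x (u x) - d / x * deriv u x) * u x - deriv u x * deriv u x) / u x ^ 2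
        = -q - d / x * p - p ^ 2 := by
      rw [hfq, hdu]
      field_simp
    rw [heq]
    have hdx : (d / x) ^ 2 ≤ lam := by
      have h1 : d ^ 2 ≤ lam * x := by
        have : d ^ 2 / lam ≤ x := by linarith
        rw [div_le_iff₀ hlam] at this
        linarith
      have h2 : 1 ≤ x := by
        have : 0 ≤ d ^ 2 / lam := by positivity
        linarith
      rw [div_pow, div_le_iff₀ (by positivity)]
      nlinarith
    have h0 : 0 < 1 + p ^ 2 := by positivity
    -- Since `(d/x)² ≤ lam`, `|(d/x) p| ≤ lam/2 + p²/2`, leaving at most `-(lam + p²)/2 ≤ -c(1 +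
    -- p²)`.
    have hmain : (-q - d / x * p - p ^ 2) + c * (1 + p ^ 2) ≤ 0 := by
      nlinarith [sq_nonneg (p + d / x), sq_nonneg p]
    have : 1 / (1 + p ^ 2) * (-q - d / x * p - p ^ 2) + c
        = ((-q - d / x * p - p ^ 2) + c * (1 + p ^ 2)) / (1 + p ^ 2) := by
      field_simp
    rw [this]
    exact div_nonpos_of_nonpos_of_nonneg hmain h0.le
  -- Over a length `π/c` the angle would drop by at least `π`, but `arctan` takes values in an open
  -- interval of that length.
  have hlen : 0 ≤ Real.pi / c := by positivity
  have h1 := hanti (mem_Ici.2 le_rfl) (mem_Ici.2 (by linarith : a ≤ a + Real.pi / c))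
    (by linarith)
  have h2 := Real.arctan_lt_pi_div_two (deriv u a / u a)
  have h3 := Real.neg_pi_div_two_lt_arctan (deriv u (a + Real.pi / c) / u (a + Real.pi / c))
  have h4 : c * (a + Real.pi / c) = c * a + Real.pi := by field_simp
  simp only at h1
  linarith

end IsLinearlyBoundedProfile

/-! ### Differential inequalities for the modified energy and decay rates -/

namespace IsDampedProfile

variable {d : ℝ} {f : ℝ → ℝ → ℝ} {u : ℝ → ℝ}

theorem hasDerivAt_frozenEnergy_mul_exp (h : IsDampedProfile d f u) {L : ℝ → ℝ} {l x : ℝ}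
    (hx : 0 < x) (hL : HasDerivAt L l x) :
    HasDerivAt (fun y => frozenEnergy d f u x y * Real.exp (L y))
      ((deriv (frozenEnergy d f u x) x + l * modifiedEnergy d f u x) * Real.exp (L x)) x := by
  have h1 := h.hasDerivAt_frozenEnergy hx
  rw [h1.deriv]
  refine (h1.mul hL.exp).congr_deriv ?_
  rw [frozenEnergy_self]
  ring

/-- Freezing gives an upper bound to the right of `x`, so a strict differential inequality at the
single point `x` is enough. -/
theorem antitoneOn_modifiedEnergy_mul_exp (h : IsDampedProfile d f u) {R : ℝ} (hR : 0 < R)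
    {L l : ℝ → ℝ} (hL : ∀ x, R ≤ x → HasDerivAt L (l x) x)
    (hl : ∀ x, R ≤ x → deriv (frozenEnergy d f u x) x + l x * modifiedEnergy d f u x < 0) :
    AntitoneOn (fun x => modifiedEnergy d f u x * Real.exp (L x)) (Ici R) := by
  refine antitoneOn_of_eventually_le_right ?_ fun x hx => ?_
  · have h1 := h.continuousOn_modifiedEnergy.mono fun x (hx : R ≤ x) => hR.trans_le hx
    have h2 : ContinuousOn L (Ici R) := fun x hx => (hL x hx).continuousAt.continuousWithinAt
    exact h1.mul h2.rexp
  · have hx0 := hR.trans_le hx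
    have h1 := h.hasDerivAt_frozenEnergy_mul_exp hx0 (hL x hx)
    filter_upwards [h1.eventually_le_right (mul_neg_of_neg_of_pos (hl x hx) (Real.exp_pos _)),
      self_mem_nhdsWithin] with y hy hxy
    have hxy : x < y := hxy
    refine le_trans ?_ hy
    gcongr
    exact h.modifiedEnergy_le_frozenEnergy hx0.le hxy.le

/-- For lower bounds freezing errs in the wrong direction. The loss is at most `u²/2` times the
increment of `K`; `huA` makes it a fraction of the energy, paid for by the factor `exp (2 A K)`. -/
theorem monotoneOn_modifiedEnergy_mul_exp (h : IsDampedProfile d f u) {R A : ℝ} (hR : 0 < R)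
    (hA : 0 ≤ A) {K L l : ℝ → ℝ} (hL : ∀ x, R ≤ x → HasDerivAt L (l x) x)
    (hl : ∀ x, R ≤ x → 0 < deriv (frozenEnergy d f u x) x + l x * modifiedEnergy d f u x)
    (hK : Continuous K) (hKm : Monotone K)
    (hfK : ∀ x y, R ≤ x → x ≤ y →
      primitive (f x) (u y) - u y ^ 2 / 2 * (K y - K x) ≤ primitive (f y) (u y))
    (hpos : ∀ x, R ≤ x → 0 ≤ modifiedEnergy d f u x)
    (huA : ∀ x, R ≤ x → u x ^ 2 / 2 < A * modifiedEnergy d f u x) :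
    MonotoneOn (fun x => modifiedEnergy d f u x * Real.exp (L x) * Real.exp (2 * A * K x))
      (Ici R) := by
  have hLc : ContinuousOn L (Ici R) := fun x hx => (hL x hx).continuousAt.continuousWithinAt
  have h1 := h.continuousOn_modifiedEnergy.mono fun x (hx : R ≤ x) => hR.trans_le hx
  refine monotoneOn_mul_exp_of_eventually_ge_right hA (h1.mul hLc.rexp) hK hKm
    (fun x hx => _root_.mul_nonneg (hpos x hx) (Real.exp_pos _).le) fun x hx => ?_
  have hx0 := hR.trans_le hx
  have h2 := h.hasDerivAt_frozenEnergy_mul_exp hx0 (hL x hx)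
  -- The strict inequality `huA` at `x` persists for `y` near `x` by continuity.
  have h3 : ∀ᶠ y in 𝓝[>] x, u y ^ 2 / 2 * Real.exp (L y)
      < A * modifiedEnergy d f u x * Real.exp (L x) := by
    have hc : ContinuousAt (fun y => u y ^ 2 / 2 * Real.exp (L y)) x :=
      ((h.continuous.continuousAt.pow 2).div_const 2).mul (hL x hx).continuousAt.rexp
    refine (hc.eventually (gt_mem_nhds ?_)).filter_mono inf_le_left
    exact mul_lt_mul_of_pos_right (huA x hx) (Real.exp_pos _)
  filter_upwards [h2.eventually_ge_right (mul_pos (hl x hx) (Real.exp_pos _)), h3,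
    self_mem_nhdsWithin] with y hy hy3 hxy
  have hxy : x < y := hxy
  have hΔ : 0 ≤ K y - K x := sub_nonneg.2 (hKm hxy.le)
  have h4 : frozenEnergy d f u x y - u y ^ 2 / 2 * (K y - K x) ≤ modifiedEnergy d f u y := by
    have := hfK x y hx hxy.le
    simp only [frozenEnergy, modifiedEnergy, energy]
    linarith
  rw [frozenEnergy_self] at hy
  have h5 := mul_le_mul_of_nonneg_right h4 (Real.exp_pos (L y)).le
  nlinarith [mul_le_mul_of_nonneg_right hy3.le hΔ]

/-- At the exact rate `d/x` the leading terms cancel. What remains is the defect `2F - u f`, zero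
for linear `f`, and a term of order `x⁻²`. -/
theorem deriv_frozenEnergy_add (h : IsDampedProfile d f u) {x : ℝ} (hx : 0 < x) :
    deriv (frozenEnergy d f u x) x + d / x * modifiedEnergy d f u x =
      d / (2 * x) * (2 * primitive (f x) (u x) - u x * f x (u x))
        - d / (2 * x ^ 2) * (u x * deriv u x) := by
  rw [(h.hasDerivAt_frozenEnergy hx).deriv, modifiedEnergy, energy]
  field_simp
  ring

end IsDampedProfile

namespace IsLinearlyBoundedProfile

variable {d lam Lam : ℝ} {f : ℝ → ℝ → ℝ} {u : ℝ → ℝ}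

theorem energy_bounds (h : IsLinearlyBoundedProfile d lam Lam f u) {r : ℝ} (hr : 0 ≤ r) :
    min 1 lam / 2 * (u r ^ 2 + deriv u r ^ 2) ≤ energy f u r ∧
      energy f u r ≤ (1 + Lam) / 2 * (u r ^ 2 + deriv u r ^ 2) := by
  have h1 := h.primitive_bounds hr
  have hLam := h.upper_pos
  have hu := sq_nonneg (u r)
  have hv := sq_nonneg (deriv u r)
  unfold energy
  constructor
  · nlinarith [min_le_left 1 lam, min_le_right 1 lam]
  · nlinarith

/-- The factor `d + 1` serves both the cross term in the energy and the larger one, `d(d+1)/(2r²) u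
u'`, in its derivative. -/
theorem abs_cross_le (h : IsLinearlyBoundedProfile d lam Lam f u) {r : ℝ}
    (hr : (d + 1) / min 1 lam ≤ r) :
    (d + 1) / r * |u r * deriv u r| ≤ min 1 lam / 2 * (u r ^ 2 + deriv u r ^ 2) := by
  have hm : 0 < min 1 lam := lt_min one_pos h.lower_pos
  have hd := h.damping_pos
  have hr0 : 0 < r := lt_of_lt_of_le (by positivity) hr
  have h1 : (d + 1) / r ≤ min 1 lam := by
    rw [div_le_iff₀ hm] at hr
    rw [div_le_iff₀ hr0]
    linarith
  have h2 : |u r * deriv u r| ≤ (u r ^ 2 + deriv u r ^ 2) / 2 := by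
    rw [abs_mul]
    nlinarith [sq_nonneg (|u r| - |deriv u r|), sq_abs (u r), sq_abs (deriv u r)]
  calc (d + 1) / r * |u r * deriv u r| ≤ min 1 lam * ((u r ^ 2 + deriv u r ^ 2) / 2) := by gcongr
    _ = _ := by ring

theorem modifiedEnergy_bounds (h : IsLinearlyBoundedProfile d lam Lam f u) {r : ℝ}
    (hr : (d + 1) / min 1 lam ≤ r) :
    min 1 lam / 4 * (u r ^ 2 + deriv u r ^ 2) ≤ modifiedEnergy d f u r ∧
      modifiedEnergy d f u r ≤ (1 + Lam) * (u r ^ 2 + deriv u r ^ 2) := by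
  have hm : 0 < min 1 lam := lt_min one_pos h.lower_pos
  have hd := h.damping_pos
  have hr0 : 0 < r := lt_of_lt_of_le (by positivity) hr
  have h1 := h.energy_bounds hr0.le
  have h2 := h.abs_cross_le hr
  have h3 : |d / (2 * r) * (u r * deriv u r)| ≤ min 1 lam / 4 * (u r ^ 2 + deriv u r ^ 2) := by
    rw [abs_mul, abs_of_pos (by positivity)]
    have : d / (2 * r) ≤ (d + 1) / r / 2 := by
      rw [div_div, mul_comm r 2]
      gcongr
      linarith
    nlinarith [abs_nonneg (u r * deriv u r)]
  have h4 := abs_le.1 h3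
  have h5 := sq_nonneg (u r)
  have h6 := sq_nonneg (deriv u r)
  have h7 := min_le_left 1 lam
  have hLam := h.upper_pos
  unfold modifiedEnergy
  constructor
  · linarith
  · nlinarith

theorem one_le_threshold (h : IsLinearlyBoundedProfile d lam Lam f u) :
    1 ≤ (d + 1) / min 1 lam := by
  have hm : 0 < min 1 lam := lt_min one_pos h.lower_pos
  rw [le_div_iff₀ hm]
  linarith [min_le_left 1 lam, h.damping_pos]

/-- The phase vector decays at least like a power of `r`. -/
theorem exists_rpow_decay (h : IsLinearlyBoundedProfile d lam Lam f u) {a : ℝ}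
    (hpos : ∀ r, a ≤ r → 0 < u r ^ 2 + deriv u r ^ 2) :
    ∃ c B R : ℝ, 0 < c ∧ 0 < B ∧ 1 ≤ R ∧ ∀ r, R ≤ r →
      u r ^ 2 + deriv u r ^ 2 ≤ B * r ^ (-c) := by
  have hm : 0 < min 1 lam := lt_min one_pos h.lower_pos
  have hd := h.damping_pos
  have hLam := h.upper_pos
  set R := max a ((d + 1) / min 1 lam) with hRdef
  have hR1 : 1 ≤ R := h.one_le_threshold.trans (le_max_right _ _)
  have hR0 : 0 < R := by linarith
  -- After the cross term is absorbed, the dissipation is at least `(d min(1,lam)/4)(u² + u'²)/x`;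
  -- with energy at most `(1+Lam)(u² + u'²)`, this `c` uses half of it.
  set c := d * min 1 lam / (8 * (1 + Lam)) with hc
  have hc0 : 0 < c := by positivity
  have hcL : c * (1 + Lam) = d * min 1 lam / 8 := by
    rw [hc]
    field_simp
  have hanti : AntitoneOn (fun x => modifiedEnergy d f u x * Real.exp (c * Real.log x)) (Ici R) := by
    refine h.antitoneOn_modifiedEnergy_mul_exp hR0 (l := fun x => c * x⁻¹)
      (fun x hx => (Real.hasDerivAt_log (hR0.trans_le hx).ne').const_mul c) fun x hx => ?_
    have hx0 : 0 < x := hR0.trans_le hx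
    have hxt : (d + 1) / min 1 lam ≤ x := (le_max_right _ _).trans hx
    have hQ := hpos x ((le_max_left _ _).trans hx)
    rw [(h.hasDerivAt_frozenEnergy hx0).deriv]
    have h1 := (abs_le.1 (le_of_eq_of_le (by rw [abs_mul, abs_of_pos (by positivity)])
      (h.abs_cross_le hxt) : |(d + 1) / x * (u x * deriv u x)| ≤ _)).1
    have h2 := (h.modifiedEnergy_bounds hxt).2
    have h3 := (h.growth x hx0.le (u x) right_mem_uIcc).1
    have h4 : min 1 lam * (u x ^ 2 + deriv u x ^ 2) ≤ deriv u x ^ 2 + f x (u x) * u x := by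
      nlinarith [min_le_left 1 lam, min_le_right 1 lam, sq_nonneg (u x), sq_nonneg (deriv u x)]
    have h5 : c * modifiedEnergy d f u x ≤ d * min 1 lam / 8 * (u x ^ 2 + deriv u x ^ 2) := by
      rw [← hcL, mul_assoc]
      gcongr
    have heq : -(d / (2 * x)) * (deriv u x ^ 2 + f x (u x) * u x)
        - d * (d + 1) / (2 * x ^ 2) * (u x * deriv u x) + c * x⁻¹ * modifiedEnergy d f u x
        = x⁻¹ * (c * modifiedEnergy d f u x - d / 2 * (deriv u x ^ 2 + f x (u x) * u x)
          - d / 2 * ((d + 1) / x * (u x * deriv u x))) := by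
      field_simp
      ring
    rw [heq]
    refine mul_neg_of_pos_of_neg (by positivity) ?_
    have h6 : 0 < d * min 1 lam * (u x ^ 2 + deriv u x ^ 2) := by positivity
    nlinarith
  set V0 := modifiedEnergy d f u R * Real.exp (c * Real.log R) with hV0
  have hV0pos : 0 < V0 := by
    have := (h.modifiedEnergy_bounds (r := R) (le_max_right _ _)).1
    have hQ := hpos R (le_max_left _ _)
    have : 0 < modifiedEnergy d f u R := lt_of_lt_of_le (by positivity) this
    positivity
  refine ⟨c, V0 * (4 / min 1 lam), R, hc0, by positivity, hR1, fun r hr => ?_⟩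
  have hr0 : 0 < r := hR0.trans_le hr
  have h1 := hanti (mem_Ici.2 le_rfl) (mem_Ici.2 hr) hr
  have h2 := (h.modifiedEnergy_bounds ((le_max_right _ _).trans hr)).1
  have hexp : Real.exp (c * Real.log r) = r ^ c := by
    rw [Real.rpow_def_of_pos hr0, mul_comm]
  simp only [hexp] at h1
  rw [Real.rpow_neg hr0.le, ← div_eq_mul_inv, le_div_iff₀ (by positivity)]
  have h3 : min 1 lam / 4 * (u r ^ 2 + deriv u r ^ 2) * r ^ c ≤ V0 :=
    (mul_le_mul_of_nonneg_right h2 (by positivity)).trans (by simpa [hexp] using h1)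
  calc (u r ^ 2 + deriv u r ^ 2) * r ^ c
      = min 1 lam / 4 * (u r ^ 2 + deriv u r ^ 2) * r ^ c * (4 / min 1 lam) := by
        field_simp
    _ ≤ V0 * (4 / min 1 lam) := by gcongr

theorem tendsto_zero (h : IsLinearlyBoundedProfile d lam Lam f u) {a : ℝ}
    (hpos : ∀ r, a ≤ r → 0 < u r ^ 2 + deriv u r ^ 2) : Tendsto u atTop (𝓝 0) := by
  obtain ⟨c, B, R, hc, -, -, hdec⟩ := h.exists_rpow_decay hpos
  have h1 : Tendsto (fun r : ℝ => B * r ^ (-c)) atTop (𝓝 0) := by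
    simpa using (tendsto_rpow_neg_atTop hc).const_mul B
  have h2 : Tendsto (fun r => u r ^ 2) atTop (𝓝 0) := by
    refine squeeze_zero' (Eventually.of_forall fun r => sq_nonneg (u r)) ?_ h1
    filter_upwards [eventually_ge_atTop R] with r hr
    linarith [hdec r hr, sq_nonneg (deriv u r)]
  have h3 := h2.sqrt
  simp only [Real.sqrt_sq_eq_abs, Real.sqrt_zero] at h3
  exact (tendsto_zero_iff_abs_tendsto_zero _).2 h3

/-- Polynomial decay turns the logarithmic weight in `u` into one in `r`. -/
theorem exists_log_weight_le (h : IsLinearlyBoundedProfile d lam Lam f u) {a σ : ℝ} (hσ : 0 < σ)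
    (hpos : ∀ r, a ≤ r → 0 < u r ^ 2 + deriv u r ^ 2) :
    ∃ B R : ℝ, 0 < B ∧ 1 < R ∧ ∀ r, R ≤ r →
      u r ^ 2 * |Real.log (abs (u r))| ^ (-1 - σ) ≤ B * u r ^ 2 * Real.log r ^ (-1 - σ) := by
  obtain ⟨c, B, R, hc, hB, hR, hdec⟩ := h.exists_rpow_decay hpos
  -- Beyond the threshold `log B ≤ (c/2) log r`, so `|log|u|| ≥ (c/4) log r`; the negative exponent
  -- reverses the inequality.
  refine ⟨(c / 4) ^ (-1 - σ), max (R + 1) (Real.exp (2 * Real.log B / c)), by positivity,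
    lt_of_lt_of_le (by linarith) (le_max_left _ _), fun r hr => ?_⟩
  have hrR : R + 1 ≤ r := (le_max_left _ _).trans hr
  have hr1 : 1 < r := by linarith
  have hlog : 0 < Real.log r := Real.log_pos hr1
  rcases eq_or_ne (u r) 0 with hu | hu
  · simp [hu]
  · have hua : 0 < |u r| := abs_pos.2 hu
    have h1 : u r ^ 2 ≤ B * r ^ (-c) := by linarith [hdec r (by linarith), sq_nonneg (deriv u r)]
    have h2 : 2 * Real.log |u r| ≤ Real.log B - c * Real.log r := by
      have h3 := Real.log_le_log (by positivity) h1
      rw [Real.log_mul hB.ne' (by positivity), Real.log_rpow (by linarith), ← sq_abs,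
        Real.log_pow] at h3
      push_cast at h3
      linarith
    have h4 : 2 * Real.log B ≤ c * Real.log r := by
      have h5 : 2 * Real.log B / c ≤ Real.log r :=
        (Real.le_log_iff_exp_le (by linarith)).2 ((le_max_right _ _).trans hr)
      rw [div_le_iff₀ hc] at h5
      linarith
    have h6 : c / 4 * Real.log r ≤ |Real.log (abs (u r))| := by
      linarith [neg_le_abs (Real.log |u r|)]
    have h7 := Real.rpow_le_rpow_of_nonpos (by positivity) h6 (by linarith : -1 - σ ≤ 0)
    rw [Real.mul_rpow (by positivity) hlog.le] at h7
    calc u r ^ 2 * |Real.log (abs (u r))| ^ (-1 - σ)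
        ≤ u r ^ 2 * ((c / 4) ^ (-1 - σ) * Real.log r ^ (-1 - σ)) := by gcongr
      _ = _ := by ring

/-- Two-sided decay of the phase vector at the rate `r^(-d/2)`. -/
theorem exists_sharp_decay (h : IsLinearlyBoundedProfile d lam Lam f u) {a σ C : ℝ} (hσ : 0 < σ)
    (hC : 0 < C) (hpos : ∀ r, a ≤ r → 0 < u r ^ 2 + deriv u r ^ 2)
    (hlog : ∀ r, a ≤ r → |2 * primitive (f r) (u r) - u r * f r (u r)| ≤
      C * u r ^ 2 * |Real.log (abs (u r))| ^ (-1 - σ))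
    {K : ℝ → ℝ} {Kmax : ℝ} (hK : Continuous K) (hKm : Monotone K) (hKmax : ∀ r, K r ≤ Kmax)
    (hfK : ∀ x y, a ≤ x → x ≤ y →
      primitive (f x) (u y) - u y ^ 2 / 2 * (K y - K x) ≤ primitive (f y) (u y)) :
    ∃ R c₁ c₂ : ℝ, 1 ≤ R ∧ 0 < c₁ ∧ 0 < c₂ ∧ ∀ r, R ≤ r →
      c₁ ≤ (u r ^ 2 + deriv u r ^ 2) * r ^ d ∧ (u r ^ 2 + deriv u r ^ 2) * r ^ d ≤ c₂ := by
  have hm : 0 < min 1 lam := lt_min one_pos h.lower_pos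
  have hd := h.damping_pos
  have hLam := h.upper_pos
  obtain ⟨B, R₁, hB, hR₁, hwt⟩ := h.exists_log_weight_le hσ hpos
  set R := max (max a R₁) ((d + 1) / min 1 lam) with hRdef
  have hRa : a ≤ R := (le_max_left _ _).trans (le_max_left _ _)
  have hRR₁ : R₁ ≤ R := (le_max_right _ _).trans (le_max_left _ _)
  have hRt : (d + 1) / min 1 lam ≤ R := le_max_right _ _
  have hR1 : 1 < R := hR₁.trans_le hRR₁
  have hR0 : 0 < R := by linarith
  -- The factor `4 / min 1 lam` converts `u² + u'²` into energy. The summands `d + 1` cover the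
  -- `x⁻²` error strictly and also give `u²/2 < A V`.
  set A : ℝ := 4 / min 1 lam * (d * C * B + d + 1) with hA
  have hA0 : 0 < A := by positivity
  have hVlow : ∀ x, R ≤ x → (d * C * B + d + 1) * (u x ^ 2 + deriv u x ^ 2)
      ≤ A * modifiedEnergy d f u x := by
    intro x hx
    have h1 := (h.modifiedEnergy_bounds (hRt.trans hx)).1
    calc (d * C * B + d + 1) * (u x ^ 2 + deriv u x ^ 2)
        = A * (min 1 lam / 4 * (u x ^ 2 + deriv u x ^ 2)) := by
          rw [hA]
          field_simp
      _ ≤ A * modifiedEnergy d f u x := by gcongr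
  set ω : ℝ → ℝ := fun x => Real.log x ^ (-1 - σ) / x + 1 / x ^ 2 with hω
  have hmain : ∀ x, R ≤ x → |deriv (frozenEnergy d f u x) x + d / x * modifiedEnergy d f u x|
      < A * ω x * modifiedEnergy d f u x := by
    intro x hx
    have hx1 : 1 < x := hR1.trans_le hx
    have hx0 : 0 < x := by linarith
    have hlx : 0 < Real.log x := Real.log_pos hx1
    have hQ := hpos x (hRa.trans hx)
    set Q := u x ^ 2 + deriv u x ^ 2 with hQdef
    have hw : 0 < Real.log x ^ (-1 - σ) := by positivity
    rw [h.deriv_frozenEnergy_add hx0]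
    have h1 : |2 * primitive (f x) (u x) - u x * f x (u x)|
        ≤ C * B * Q * Real.log x ^ (-1 - σ) := by
      refine (hlog x (hRa.trans hx)).trans ?_
      have h2 := hwt x (hRR₁.trans hx)
      have h3 : u x ^ 2 ≤ Q := by rw [hQdef]; linarith [sq_nonneg (deriv u x)]
      calc C * u x ^ 2 * |Real.log (abs (u x))| ^ (-1 - σ)
          = C * (u x ^ 2 * |Real.log (abs (u x))| ^ (-1 - σ)) := by ring
        _ ≤ C * (B * u x ^ 2 * Real.log x ^ (-1 - σ)) := by gcongr
        _ ≤ C * (B * Q * Real.log x ^ (-1 - σ)) := by gcongr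
        _ = _ := by ring
    have h2 : |u x * deriv u x| ≤ Q := by
      rw [abs_mul]
      nlinarith [sq_nonneg (|u x| - |deriv u x|), sq_abs (u x), sq_abs (deriv u x)]
    calc |d / (2 * x) * (2 * primitive (f x) (u x) - u x * f x (u x))
          - d / (2 * x ^ 2) * (u x * deriv u x)|
        ≤ d / (2 * x) * |2 * primitive (f x) (u x) - u x * f x (u x)|
          + d / (2 * x ^ 2) * |u x * deriv u x| := by
          refine (abs_sub _ _).trans (le_of_eq ?_)
          rw [abs_mul, abs_mul, abs_of_pos (by positivity : 0 < d / (2 * x)),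
            abs_of_pos (by positivity : 0 < d / (2 * x ^ 2))]
      _ ≤ d / (2 * x) * (C * B * Q * Real.log x ^ (-1 - σ)) + d / (2 * x ^ 2) * Q := by gcongr
      _ = (d * C * B / 2) * (Real.log x ^ (-1 - σ) / x) * Q + d / 2 * (1 / x ^ 2) * Q := by
          field_simp
      _ < (d * C * B + d + 1) * (Real.log x ^ (-1 - σ) / x) * Q
          + (d * C * B + d + 1) * (1 / x ^ 2) * Q := by
          have : 0 < d * C * B := by positivity
          gcongr <;> linarith
      _ = ω x * ((d * C * B + d + 1) * Q) := by
          rw [hω]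
          ring
      _ ≤ ω x * (A * modifiedEnergy d f u x) := by
          have := hVlow x hx
          gcongr
      _ = A * ω x * modifiedEnergy d f u x := by ring
  -- An antiderivative of the error weight; `m ≤ 0` is the bound that removes the exponential
  -- corrections.
  set m : ℝ → ℝ := fun x => -(Real.log x ^ (-σ) / σ) - 1 / x with hmdef
  have hmder : ∀ x, R ≤ x → HasDerivAt m (ω x) x := by
    intro x hx
    have hx1 : 1 < x := hR1.trans_le hx
    have hlx : 0 < Real.log x := Real.log_pos hx1
    have h1 := ((((Real.hasDerivAt_log (by linarith)).rpow_const (p := -σ)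
      (Or.inl hlx.ne')).div_const σ).neg).sub (hasDerivAt_inv (by linarith : x ≠ 0))
    have h2 : m = (-fun x => Real.log x ^ (-σ) / σ) - fun y => y⁻¹ := by
      funext y
      simp [hmdef, one_div]
    rw [h2]
    refine h1.congr_deriv ?_
    rw [hω, show -1 - σ = -σ - 1 by ring]
    field_simp
    ring
  have hmneg : ∀ x, R ≤ x → m x ≤ 0 := by
    intro x hx
    have hx1 : 1 < x := hR1.trans_le hx
    have hlx : 0 < Real.log x := Real.log_pos hx1
    have h1 : 0 < Real.log x ^ (-σ) / σ := by positivity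
    have h2 : 0 < 1 / x := by positivity
    simp only [hmdef]
    linarith
  have hVpos : ∀ x, R ≤ x → 0 < modifiedEnergy d f u x := fun x hx => by
    have := hpos x (hRa.trans hx)
    exact lt_of_lt_of_le (by positivity) (h.modifiedEnergy_bounds (hRt.trans hx)).1
  have hup := h.antitoneOn_modifiedEnergy_mul_exp hR0 (L := fun x => d * Real.log x - A * m x)
    (l := fun x => d * x⁻¹ - A * ω x)
    (fun x hx => ((Real.hasDerivAt_log (hR0.trans_le hx).ne').const_mul d).sub
      ((hmder x hx).const_mul A))
    (fun x hx => by
      have := (abs_lt.1 (hmain x hx)).2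
      rw [div_eq_mul_inv] at this
      linarith)
  have hlo := h.monotoneOn_modifiedEnergy_mul_exp hR0 hA0.le
    (L := fun x => d * Real.log x + A * m x) (l := fun x => d * x⁻¹ + A * ω x)
    (fun x hx => ((Real.hasDerivAt_log (hR0.trans_le hx).ne').const_mul d).add
      ((hmder x hx).const_mul A))
    (fun x hx => by
      have := (abs_lt.1 (hmain x hx)).1
      rw [div_eq_mul_inv] at this
      linarith)
    hK hKm (fun x y hx hxy => hfK x y (hRa.trans hx) hxy) (fun x hx => (hVpos x hx).le)
    (fun x hx => by
      have h1 := hVlow x hx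
      have h2 := hpos x (hRa.trans hx)
      have h3 : 0 < d * C * B + d := by positivity
      nlinarith [sq_nonneg (deriv u x), sq_nonneg (u x)])
  have hexp : ∀ x, R ≤ x → Real.exp (d * Real.log x) = x ^ d := fun x hx => by
    rw [Real.rpow_def_of_pos (hR0.trans_le hx), mul_comm]
  set U := modifiedEnergy d f u R * Real.exp (d * Real.log R - A * m R) with hU
  set W := modifiedEnergy d f u R * Real.exp (d * Real.log R + A * m R)
    * Real.exp (2 * A * K R) with hW
  have hVR := hVpos R le_rfl
  have hU0 : 0 < U := by positivity
  have hW0 : 0 < W := by positivity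
  refine ⟨R, W * Real.exp (-(2 * A * Kmax)) / (1 + Lam), U * (4 / min 1 lam), hR1.le,
    by positivity, by positivity, fun r hr => ?_⟩
  have hr0 : 0 < r := hR0.trans_le hr
  have hrd : 0 < r ^ d := by positivity
  have h1 : modifiedEnergy d f u r * Real.exp (d * Real.log r - A * m r) ≤ U :=
    hup (mem_Ici.2 le_rfl) (mem_Ici.2 hr) hr
  have h2 : W ≤ modifiedEnergy d f u r * Real.exp (d * Real.log r + A * m r)
      * Real.exp (2 * A * K r) := hlo (mem_Ici.2 le_rfl) (mem_Ici.2 hr) hr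
  have hAm : A * m r ≤ 0 := mul_nonpos_of_nonneg_of_nonpos hA0.le (hmneg r hr)
  have hVr := hVpos r hr
  obtain ⟨hV1, hV2⟩ := h.modifiedEnergy_bounds (hRt.trans hr)
  constructor
  · rw [div_le_iff₀ (by positivity)]
    calc W * Real.exp (-(2 * A * Kmax))
        ≤ modifiedEnergy d f u r * Real.exp (d * Real.log r + A * m r)
          * Real.exp (2 * A * K r) * Real.exp (-(2 * A * Kmax)) := by gcongr
      _ ≤ modifiedEnergy d f u r * Real.exp (d * Real.log r)
          * Real.exp (2 * A * Kmax) * Real.exp (-(2 * A * Kmax)) := by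
          have := hKmax r
          gcongr
          linarith
      _ = modifiedEnergy d f u r * r ^ d := by
          rw [mul_assoc, ← Real.exp_add, add_neg_cancel, Real.exp_zero, mul_one, hexp r hr]
      _ ≤ (1 + Lam) * (u r ^ 2 + deriv u r ^ 2) * r ^ d := by gcongr
      _ = _ := by ring
  · have h3 : min 1 lam / 4 * (u r ^ 2 + deriv u r ^ 2) * r ^ d ≤ U := by
      calc min 1 lam / 4 * (u r ^ 2 + deriv u r ^ 2) * r ^ d
          ≤ modifiedEnergy d f u r * Real.exp (d * Real.log r) := by
            rw [hexp r hr]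
            gcongr
        _ ≤ modifiedEnergy d f u r * Real.exp (d * Real.log r - A * m r) := by
            gcongr
            linarith
        _ ≤ U := h1
    calc (u r ^ 2 + deriv u r ^ 2) * r ^ d
        = min 1 lam / 4 * (u r ^ 2 + deriv u r ^ 2) * r ^ d * (4 / min 1 lam) := by
          field_simp
      _ ≤ U * (4 / min 1 lam) := by gcongr

end IsLinearlyBoundedProfile

/-! ### From asymptotic bounds to bounds on `[1,∞)` -/

/-- A positive continuous function on `[1,∞)` with two-sided bounds near infinity has two-sided
bounds on `[1,∞)`. -/
theorem exists_two_sided_bound_Ici {T : ℝ → ℝ} {R c₁ c₂ : ℝ} (hT : ContinuousOn T (Ici 1))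
    (hpos : ∀ r, 1 ≤ r → 0 < T r) (hR : 1 ≤ R) (hc₁ : 0 < c₁)
    (hfar : ∀ r, R ≤ r → c₁ ≤ T r ∧ T r ≤ c₂) :
    ∃ c C : ℝ, 0 < c ∧ 0 < C ∧ ∀ r, 1 ≤ r → c ≤ T r ∧ T r ≤ C := by
  have hT' : ContinuousOn T (Icc 1 R) := hT.mono fun x hx => hx.1
  have hne : (Icc 1 R).Nonempty := ⟨1, left_mem_Icc.2 hR⟩
  obtain ⟨p, hp, hmin⟩ := isCompact_Icc.exists_isMinOn hne hT'
  obtain ⟨q, hq, hmax⟩ := isCompact_Icc.exists_isMaxOn hne hT'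
  refine ⟨min c₁ (T p), max c₂ (T q), lt_min hc₁ (hpos p hp.1),
    lt_max_of_lt_right (hpos q hq.1), fun r hr => ?_⟩
  rcases le_total r R with h | h
  · exact ⟨(min_le_right _ _).trans (hmin ⟨hr, h⟩), (hmax ⟨hr, h⟩).trans (le_max_right _ _)⟩
  · exact ⟨(min_le_left _ _).trans (hfar r h).1, (hfar r h).2.trans (le_max_left _ _)⟩

/-- The quantities `|u| + |u'|` and `(u² + u'²)^(1/2)` are comparable. The equation bounds `u''` by
them from above, and `|u''|` is dropped from below. -/
theorem IsLinearlyBoundedProfile.exists_two_sided_rate {d lam Lam : ℝ} {f : ℝ → ℝ → ℝ}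
    {u : ℝ → ℝ} (h : IsLinearlyBoundedProfile d lam Lam f u) {R c₁ c₂ : ℝ} (hR : 1 ≤ R)
    (hpos : ∀ r, 1 ≤ r → 0 < u r ^ 2 + deriv u r ^ 2) (hc₁ : 0 < c₁)
    (hfar : ∀ r, R ≤ r →
      c₁ ≤ (u r ^ 2 + deriv u r ^ 2) * r ^ d ∧ (u r ^ 2 + deriv u r ^ 2) * r ^ d ≤ c₂) :
    ∃ c C : ℝ, 0 < c ∧ 0 < C ∧ ∀ r, 1 ≤ r →
      c * r ^ (-(d / 2)) ≤ |u r| + |deriv u r| + |deriv (deriv u) r| ∧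
      |u r| + |deriv u r| + |deriv (deriv u) r| ≤ C * r ^ (-(d / 2)) := by
  have hd := h.damping_pos
  have hLam := h.upper_pos
  have hu := h.continuous
  have hu' := h.continuous_deriv
  have hu'' := h.continuous_deriv_deriv
  have hsum : ∀ r, 0 ≤ |deriv (deriv u) r| := fun r => abs_nonneg _
  have key : ∃ c C : ℝ, 0 < c ∧ 0 < C ∧ ∀ r, 1 ≤ r →
      c ≤ (|u r| + |deriv u r| + |deriv (deriv u) r|) * r ^ (d / 2) ∧
      (|u r| + |deriv u r| + |deriv (deriv u) r|) * r ^ (d / 2) ≤ C := by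
    refine exists_two_sided_bound_Ici (R := R) (c₁ := Real.sqrt c₁)
      (c₂ := (1 + Lam + d) * Real.sqrt (2 * c₂)) ?_ ?_ hR (by positivity) ?_
    · refine ContinuousOn.mul (by fun_prop) (continuousOn_id.rpow_const fun x hx => Or.inl ?_)
      have : (1 : ℝ) ≤ x := hx
      simp only [id]
      linarith
    · intro r hr
      refine mul_pos ?_ (by positivity)
      by_contra hle
      have h0 : |u r| = 0 := by
        linarith [abs_nonneg (u r), abs_nonneg (deriv u r), hsum r]
      have h1 : |deriv u r| = 0 := by
        linarith [abs_nonneg (u r), abs_nonneg (deriv u r), hsum r]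
      have := hpos r hr
      simp [abs_eq_zero.1 h0, abs_eq_zero.1 h1] at this
    · intro r hr
      have hr1 : 1 ≤ r := hR.trans hr
      have hr0 : 0 < r := by linarith
      obtain ⟨h1, h2⟩ := hfar r hr
      have hp : 0 < r ^ (d / 2) := by positivity
      have hsq : r ^ d = (r ^ (d / 2)) ^ 2 := by
        rw [← Real.rpow_natCast, ← Real.rpow_mul hr0.le]
        norm_num
      set S := |u r| + |deriv u r| with hS
      have hS0 : 0 ≤ S := by positivity
      have hQS : u r ^ 2 + deriv u r ^ 2 ≤ S ^ 2 := by
        nlinarith [sq_abs (u r), sq_abs (deriv u r), abs_nonneg (u r), abs_nonneg (deriv u r)]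
      have hSQ : S ^ 2 ≤ 2 * (u r ^ 2 + deriv u r ^ 2) := by
        nlinarith [sq_abs (u r), sq_abs (deriv u r), sq_nonneg (|u r| - |deriv u r|)]
      rw [hsq] at h1 h2
      constructor
      · have h3 : Real.sqrt c₁ ≤ S * r ^ (d / 2) := by
          refine Real.sqrt_le_iff.2 ⟨by positivity, ?_⟩
          rw [mul_pow]
          exact h1.trans (by gcongr)
        refine h3.trans ?_
        gcongr
        linarith [hsum r]
      · have h3 : S * r ^ (d / 2) ≤ Real.sqrt (2 * c₂) := by
          refine Real.le_sqrt_of_sq_le ?_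
          rw [mul_pow]
          calc S ^ 2 * (r ^ (d / 2)) ^ 2
              ≤ 2 * (u r ^ 2 + deriv u r ^ 2) * (r ^ (d / 2)) ^ 2 := by gcongr
            _ ≤ 2 * c₂ := by linarith
        have h4 : |deriv (deriv u) r| ≤ (Lam + d) * S := by
          rw [h.deriv_deriv_eq hr0]
          have h5 := h.abs_apply_le hr0.le
          have h6 : |d / r * deriv u r| ≤ d * |deriv u r| := by
            rw [abs_mul, abs_of_pos (by positivity)]
            gcongr
            exact div_le_self hd.le hr1
          have h7 := abs_sub (-f r (u r)) (d / r * deriv u r)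
          rw [abs_neg] at h7
          nlinarith [abs_nonneg (u r), abs_nonneg (deriv u r)]
        calc (S + |deriv (deriv u) r|) * r ^ (d / 2)
            ≤ (S + (Lam + d) * S) * r ^ (d / 2) := by gcongr
          _ = (1 + Lam + d) * (S * r ^ (d / 2)) := by ring
          _ ≤ (1 + Lam + d) * Real.sqrt (2 * c₂) := by gcongr
  obtain ⟨c, C, hc, hC, hcC⟩ := key
  refine ⟨c, C, hc, hC, fun r hr => ?_⟩
  have hr0 : 0 < r := by linarith
  have hp : 0 < r ^ (d / 2) := by positivity
  rw [Real.rpow_neg hr0.le, ← div_eq_mul_inv, ← div_eq_mul_inv, div_le_iff₀ hp, le_div_iff₀ hp]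
  exact hcC r hr

/-! ### Variation in `r`, truncation and trapping -/

theorem antitoneOn_mul_of_partialR {g : ℝ → ℝ → ℝ} {z : ℝ}
    (hg : ContDiffOn ℝ 1 (fun r => g r z) (Ici 0)) (hs : ∀ r, 0 ≤ r → partialR g r z * z ≤ 0) :
    AntitoneOn (fun r => g r z * z) (Ici 0) := by
  have hd : DifferentiableOn ℝ (fun r => g r z) (Ici 0) := hg.differentiableOn (by norm_num)
  refine antitoneOn_of_deriv_nonpos (convex_Ici 0) (hd.continuousOn.mul continuousOn_const)
    ((hd.mono interior_subset).mul_const z) fun x hx => ?_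
  rw [interior_Ici] at hx
  have hx : 0 < x := hx
  rw [deriv_mul_const ((hd x hx.le).differentiableAt (Ici_mem_nhds hx)),
    ← derivWithin_of_mem_nhds (Ici_mem_nhds hx)]
  exact hs x hx.le

theorem sub_mul_ge_of_partialR {g : ℝ → ℝ → ℝ} {z x y : ℝ} {k : ℝ → ℝ}
    (hg : ContDiffOn ℝ 1 (fun r => g r z) (Ici 0)) (hx : 0 < x) (hxy : x ≤ y)
    (hk : IntervalIntegrable k volume x y)
    (hs : ∀ r ∈ Icc x y, -k r * z ^ 2 ≤ partialR g r z * z) :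
    -(∫ r in x..y, k r) * z ^ 2 ≤ g y z * z - g x z * z := by
  have hd : DifferentiableOn ℝ (fun r => g r z) (Ici 0) := hg.differentiableOn (by norm_num)
  have hc : ContinuousOn (fun r => partialR g r z) (Ici 0) :=
    hg.continuousOn_derivWithin (uniqueDiffOn_Ici 0) le_rfl
  have hsub : uIcc x y ⊆ Ici 0 := by
    rw [uIcc_of_le hxy]
    exact fun r hr => hx.le.trans hr.1
  have hint : IntervalIntegrable (fun r => partialR g r z) volume x y :=
    (hc.mono hsub).intervalIntegrable
  have hftc : ∫ r in x..y, partialR g r z = g y z - g x z := by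
    refine intervalIntegral.integral_eq_sub_of_hasDerivAt (f := fun r => g r z) (fun r hr => ?_) hint
    rw [uIcc_of_le hxy] at hr
    have hr0 : 0 < r := hx.trans_le hr.1
    exact ((hd r hr0.le).hasDerivWithinAt).hasDerivAt (Ici_mem_nhds hr0)
  have hmono : ∫ r in x..y, -k r * z ^ 2 ≤ ∫ r in x..y, partialR g r z * z :=
    intervalIntegral.integral_mono_on hxy (hk.neg.mul_const _) (hint.mul_const _) hs
  rw [intervalIntegral.integral_mul_const, intervalIntegral.integral_mul_const, hftc,
    intervalIntegral.integral_neg] at hmono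
  linarith

/-- Projection of `z` to `[-a,b]`. -/
noncomputable def clamp (a b z : ℝ) : ℝ := max (-a) (min b z)

theorem clamp_mem {a b : ℝ} (ha : 0 < a) (hb : 0 < b) (z : ℝ) : clamp a b z ∈ Icc (-a) b :=
  ⟨le_max_left _ _, max_le (by linarith) (min_le_left _ _)⟩

theorem clamp_of_mem {a b z : ℝ} (hz : z ∈ Icc (-a) b) : clamp a b z = z := by
  rw [clamp, min_eq_right hz.2, max_eq_right hz.1]

/-- As `z` is a positive multiple of its projection, sign and monotonicity of `g(r,w) w` at `w =
clamp a b z` pass to the truncation times `z`. -/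
theorem exists_eq_mul_clamp {a b : ℝ} (ha : 0 < a) (hb : 0 < b) (z : ℝ) :
    ∃ t, 1 ≤ t ∧ z = t * clamp a b z := by
  rcases lt_or_ge z (-a) with h | h
  · refine ⟨z / (-a), ?_, ?_⟩
    · rw [le_div_iff_of_neg (by linarith)]
      linarith
    · rw [clamp, max_eq_left ((min_le_right _ _).trans h.le)]
      field_simp
  · rcases le_or_gt z b with h' | h'
    · exact ⟨1, le_rfl, by rw [clamp_of_mem ⟨h, h'⟩, one_mul]⟩
    · refine ⟨z / b, ?_, ?_⟩
      · rw [le_div_iff₀ hb]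
        linarith
      · rw [clamp, min_eq_left h'.le, max_eq_right (by linarith)]
        field_simp

/-- The nonlinearity frozen outside `[-a,b]` and extended evenly in `r`. -/
noncomputable def truncation (a b : ℝ) (g : ℝ → ℝ → ℝ) (r z : ℝ) : ℝ := g |r| (clamp a b z)

theorem continuous_truncation {a b : ℝ} {g : ℝ → ℝ → ℝ}
    (hg : ContinuousOn (Function.uncurry g) (Ici 0 ×ˢ univ)) :
    Continuous (Function.uncurry (truncation a b g)) := by
  have h : Continuous fun p : ℝ × ℝ => (|p.1|, clamp a b p.2) := by
    unfold clamp
    fun_prop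
  exact hg.comp_continuous h fun p => ⟨abs_nonneg p.1, mem_univ _⟩

theorem truncation_eq {a b r z : ℝ} {g : ℝ → ℝ → ℝ} (hr : 0 ≤ r) (hz : z ∈ Icc (-a) b) :
    truncation a b g r z = g r z := by
  rw [truncation, clamp_of_mem hz, abs_of_nonneg hr]

theorem uIcc_zero_subset {a b z : ℝ} (ha : 0 < a) (hb : 0 < b) (hz : z ∈ Icc (-a) b) :
    uIcc 0 z ⊆ Icc (-a) b :=
  uIcc_subset_Icc ⟨by linarith, hb.le⟩ hz

theorem primitive_truncation {a b r z : ℝ} {g : ℝ → ℝ → ℝ} (ha : 0 < a) (hb : 0 < b) (hr : 0 ≤ r)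
    (hz : z ∈ Icc (-a) b) : primitive (truncation a b g r) z = primitive (g r) z :=
  primitive_congr fun _ ht => truncation_eq hr (uIcc_zero_subset ha hb hz ht)

/-- If the primitive at `z` of a function with the sign of its argument is at most its values at
`-a` and `b`, then `z` lies in `[-a,b]`. -/
theorem mem_Icc_of_primitive_le {h : ℝ → ℝ} (hc : Continuous h) (hs : ∀ z, z ≠ 0 → 0 < h z * z)
    {a b z : ℝ} (ha : 0 < a) (hb : 0 < b) (hza : primitive h z ≤ primitive h (-a))
    (hzb : primitive h z ≤ primitive h b) : z ∈ Icc (-a) b := by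
  have hd : ∀ z, deriv (primitive h) z = h z := fun z => (hasDerivAt_primitive hc z).deriv
  have hcont : Continuous (primitive h) :=
    continuous_iff_continuousAt.2 fun z => (hasDerivAt_primitive hc z).continuousAt
  constructor
  · by_contra! hlt
    have hanti : StrictAntiOn (primitive h) (Iic 0) := by
      refine strictAntiOn_of_deriv_neg (convex_Iic 0) hcont.continuousOn fun t ht => ?_
      rw [interior_Iic] at ht
      have ht : t < 0 := ht
      rw [hd]
      have := hs t ht.ne
      nlinarith
    have := hanti (mem_Iic.2 (by linarith)) (mem_Iic.2 (by linarith)) hlt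
    linarith
  · by_contra! hlt
    have hmono : StrictMonoOn (primitive h) (Ici 0) := by
      refine strictMonoOn_of_deriv_pos (convex_Ici 0) hcont.continuousOn fun t ht => ?_
      rw [interior_Ici] at ht
      have ht : 0 < t := ht
      rw [hd]
      have := hs t ht.ne'
      exact pos_of_mul_pos_left this ht.le
    have := hmono (mem_Ici.2 hb.le) (mem_Ici.2 (hb.le.trans hlt.le)) hlt
    linarith

/-- The cumulative integral of an integrable nonnegative function is continuous, monotone and
bounded. -/
theorem cumulative_integral_properties {k : ℝ → ℝ} (hk : Integrable k) (h0 : ∀ r, 0 ≤ k r) :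
    Continuous (fun y => ∫ r in (0 : ℝ)..y, k r) ∧ Monotone (fun y => ∫ r in (0 : ℝ)..y, k r) ∧
      ∀ y, ∫ r in (0 : ℝ)..y, k r ≤ ∫ r, k r := by
  have hi : ∀ a b : ℝ, IntervalIntegrable k volume a b := fun a b => hk.intervalIntegrable
  refine ⟨intervalIntegral.continuous_primitive hi 0, fun x y hxy => ?_, fun y => ?_⟩
  · have h1 := intervalIntegral.integral_interval_sub_left (hi 0 y) (hi 0 x)
    have h2 : 0 ≤ ∫ r in x..y, k r := intervalIntegral.integral_nonneg hxy fun r _ => h0 r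
    simp only
    linarith
  · have hnn : 0 ≤ ∫ r, k r := integral_nonneg h0
    rcases le_total 0 y with hy | hy
    · rw [intervalIntegral.integral_of_le hy]
      exact setIntegral_le_integral hk (Eventually.of_forall h0)
    · have : 0 ≤ ∫ r in y..0, k r := intervalIntegral.integral_nonneg hy fun r _ => h0 r
      rw [intervalIntegral.integral_symm]
      linarith

/-! ### Application to the given nonlinearity -/

/-- The structural conditions on the nonlinearity `g` with limit `gInf` on `[-a,b]`. -/
structure IsAdmissible (g : ℝ → ℝ → ℝ) (gInf : ℝ → ℝ) (a b lam Lam : ℝ) : Prop where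
  left_pos : 0 < a
  right_pos : 0 < b
  lower_pos : 0 < lam
  upper_pos : 0 < Lam
  continuousOn : ContinuousOn (Function.uncurry g) (Ici 0 ×ˢ univ)
  contDiffOn : ∀ z : ℝ, ContDiffOn ℝ 1 (fun r => g r z) (Ici 0)
  continuous_limit : Continuous gInf
  sign : ∀ r : ℝ, 0 ≤ r → ∀ z ∈ Icc (-a) b, partialR g r z * z ≤ 0
  growth : ∀ r : ℝ, 0 ≤ r → ∀ z ∈ Icc (-a) b,
    lam * z ^ 2 ≤ gInf z * z ∧ gInf z * z ≤ g r z * z ∧ g r z * z ≤ Lam * z ^ 2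

namespace IsAdmissible

variable {g : ℝ → ℝ → ℝ} {gInf : ℝ → ℝ} {a b lam Lam α d : ℝ} {u : ℝ → ℝ}

theorem truncation_mul_pos (h : IsAdmissible g gInf a b lam Lam) (r : ℝ) {z : ℝ} (hz : z ≠ 0) :
    0 < truncation a b g r z * z := by
  obtain ⟨t, ht, hzt⟩ := exists_eq_mul_clamp h.left_pos h.right_pos z
  have h1 := h.growth |r| (abs_nonneg r) _ (clamp_mem h.left_pos h.right_pos z)
  have hw : clamp a b z ≠ 0 := fun h0 => hz (by rw [hzt, h0, mul_zero])
  have h2 : 0 < lam * clamp a b z ^ 2 := mul_pos h.lower_pos (by positivity)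
  calc 0 < t * (g |r| (clamp a b z) * clamp a b z) := mul_pos (by linarith) (by linarith)
    _ = truncation a b g r z * (t * clamp a b z) := by rw [truncation]; ring
    _ = _ := by rw [← hzt]

theorem truncation_mul_nonneg (h : IsAdmissible g gInf a b lam Lam) (r z : ℝ) :
    0 ≤ truncation a b g r z * z := by
  rcases eq_or_ne z 0 with rfl | hz
  · simp
  · exact (h.truncation_mul_pos r hz).le

theorem truncation_mul_antitone (h : IsAdmissible g gInf a b lam Lam) (r s z : ℝ) (hr : 0 ≤ r)
    (hrs : r ≤ s) : truncation a b g s z * z ≤ truncation a b g r z * z := by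
  obtain ⟨t, ht, hzt⟩ := exists_eq_mul_clamp h.left_pos h.right_pos z
  have hmem := clamp_mem h.left_pos h.right_pos z
  have h1 := antitoneOn_mul_of_partialR (h.contDiffOn (clamp a b z))
    (fun r hr => h.sign r hr _ hmem) (mem_Ici.2 hr) (mem_Ici.2 (hr.trans hrs)) hrs
  have h2 : ∀ r, 0 ≤ r →
      truncation a b g r z * z = t * (g r (clamp a b z) * clamp a b z) := fun r hr => by
    rw [truncation, abs_of_nonneg hr]
    nth_rewrite 2 [hzt]
    ring
  rw [h2 s (hr.trans hrs), h2 r hr]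
  exact mul_le_mul_of_nonneg_left h1 (by linarith)

theorem apply_zero (h : IsAdmissible g gInf a b lam Lam) {r : ℝ} (hr : 0 ≤ r) : g r 0 = 0 := by
  have hc : Continuous (truncation a b g r) := (continuous_truncation h.continuousOn).comp
    (by fun_prop : Continuous fun z : ℝ => (r, z))
  rw [← truncation_eq (g := g) (a := a) (b := b) hr ⟨by linarith [h.left_pos], h.right_pos.le⟩]
  exact eq_zero_of_mul_nonneg hc fun z => h.truncation_mul_nonneg r z

theorem abs_truncation_le (h : IsAdmissible g gInf a b lam Lam) (r z : ℝ) :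
    |truncation a b g r z| ≤ Lam * max a b := by
  have hmem := clamp_mem h.left_pos h.right_pos z
  have h1 := h.growth |r| (abs_nonneg r) _ hmem
  have hLam := h.upper_pos
  have hM : 0 < max a b := lt_max_of_lt_left h.left_pos
  rw [truncation]
  set w := clamp a b z
  have hw : |w| ≤ max a b := abs_le.2
    ⟨by linarith [hmem.1, le_max_left a b], hmem.2.trans (le_max_right a b)⟩
  rcases eq_or_ne w 0 with h0 | h0
  · rw [h0, h.apply_zero (abs_nonneg r), abs_zero]
    positivity
  · have h2 : 0 ≤ g |r| w * w := by
      have := mul_nonneg h.lower_pos.le (sq_nonneg w)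
      linarith
    have h3 : |g |r| w| * |w| ≤ Lam * |w| * |w| := by
      rw [← abs_mul, abs_of_nonneg h2, mul_assoc, abs_mul_abs_self]
      linarith [sq w]
    exact (le_of_mul_le_mul_right h3 (abs_pos.2 h0)).trans (by gcongr)

theorem isDampedProfile (h : IsAdmissible g gInf a b lam Lam) (hd : 0 < d) (hu : ContDiff ℝ 2 u)
    (hu0 : deriv u 0 = 0)
    (hode : ∀ r, 0 < r → -deriv (deriv u) r - d / r * deriv u r = truncation a b g r (u r)) :
    IsDampedProfile d (truncation a b g) u where
  damping_pos := hd
  continuous_uncurry := continuous_truncation h.continuousOn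
  mul_antitone := h.truncation_mul_antitone
  mul_nonneg := fun r z _ => h.truncation_mul_nonneg r z
  contDiff := hu
  deriv_zero := hu0
  ode := hode

theorem energy_le (h : IsAdmissible g gInf a b lam Lam)
    (hu : IsDampedProfile d (truncation a b g) u) (hα : u 0 ∈ Icc (-a) b) {r : ℝ} (hr : 0 ≤ r) :
    energy (truncation a b g) u r ≤ primitive (g 0) (u 0) := by
  have h1 := hu.energy_antitoneOn (mem_Ici.2 le_rfl) (mem_Ici.2 hr) hr
  have h2 : energy (truncation a b g) u 0 = primitive (g 0) (u 0) := by
    rw [energy, hu.deriv_zero, primitive_truncation h.left_pos h.right_pos le_rfl hα]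
    ring
  exact h1.trans_eq h2

/-- The energy keeps the primitive at `u r` below its values at `-a` and `b`, and the truncated
primitive is strictly monotone on each side of `0`, even beyond the interval. -/
theorem mem_range (h : IsAdmissible g gInf a b lam Lam)
    (hu : IsDampedProfile d (truncation a b g) u) (hα : u 0 ∈ Icc (-a) b)
    (hG : primitive (g 0) (u 0) ≤ min (primitive gInf (-a)) (primitive gInf b))
    {r : ℝ} (hr : 0 ≤ r) : u r ∈ Icc (-a) b := by
  have hE := h.energy_le hu hα hr
  have hP : primitive (truncation a b g r) (u r) ≤ energy (truncation a b g) u r := by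
    rw [energy]
    linarith [sq_nonneg (deriv u r)]
  have hcomp : ∀ z ∈ Icc (-a) b, primitive gInf z ≤ primitive (truncation a b g r) z := by
    intro z hz
    refine primitive_mono h.continuous_limit (hu.continuous_right r) fun t ht => ?_
    have ht' := uIcc_zero_subset h.left_pos h.right_pos hz ht
    rw [truncation_eq hr ht']
    exact (h.growth r hr t ht').2.1
  have ha := h.left_pos
  have hb := h.right_pos
  have h1 := hcomp (-a) ⟨le_rfl, by linarith⟩
  have h2 := hcomp b ⟨by linarith, le_rfl⟩
  have h3 := le_min_iff.1 hG
  exact mem_Icc_of_primitive_le (hu.continuous_right r) (fun z hz => h.truncation_mul_pos r hz)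
    ha hb (by linarith) (by linarith)

theorem isLinearlyBoundedProfile (h : IsAdmissible g gInf a b lam Lam)
    (hu : IsDampedProfile d (truncation a b g) u) (hmem : ∀ r, 0 ≤ r → u r ∈ Icc (-a) b) :
    IsLinearlyBoundedProfile d lam Lam (truncation a b g) u where
  toIsDampedProfile := hu
  lower_pos := h.lower_pos
  upper_pos := h.upper_pos
  growth := fun r hr t ht => by
    have ht' := uIcc_zero_subset h.left_pos h.right_pos (hmem r hr) ht
    rw [truncation_eq hr ht']
    have := h.growth r hr t ht'
    exact ⟨this.1.trans this.2.1, this.2.2⟩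

theorem exists_two_sided_rate (h : IsAdmissible g gInf a b lam Lam)
    (hu : IsLinearlyBoundedProfile d lam Lam (truncation a b g) u)
    (hmem : ∀ r, 0 ≤ r → u r ∈ Icc (-a) b) {x₀ : ℝ} (hx₀ : 0 < x₀) (hx₁ : x₀ ≤ 1)
    (hux₀ : u x₀ ≠ 0) (hg : AsymptoticConditions g) :
    ∃ c C : ℝ, 0 < c ∧ 0 < C ∧ ∀ r, 1 ≤ r →
      c * r ^ (-(d / 2)) ≤ |u r| + |deriv u r| + |deriv (deriv u) r| ∧
      |u r| + |deriv u r| + |deriv (deriv u) r| ≤ C * r ^ (-(d / 2)) := by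
  obtain ⟨ε, σ, C, k, hε, -, hσ, hC, hk, hcond⟩ := hg
  have hpos : ∀ r, x₀ ≤ r → 0 < u r ^ 2 + deriv u r ^ 2 := fun r hr =>
    hu.sq_add_sq_pos hx₀ hux₀ hr
  have hε0 : 0 < ε⁻¹ := inv_pos.2 hε
  have hsmall : ∀ᶠ r in atTop, |u r| < ε := by
    have := (hu.tendsto_zero hpos).abs
    rw [abs_zero] at this
    exact this.eventually (gt_mem_nhds hε)
  obtain ⟨R₀, hR₀⟩ := eventually_atTop.1 hsmall
  set R := max (max R₀ ε⁻¹) 1 with hR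
  have hRR₀ : R₀ ≤ R := (le_max_left _ _).trans (le_max_left _ _)
  have hRε : ε⁻¹ ≤ R := (le_max_right _ _).trans (le_max_left _ _)
  have hR1 : 1 ≤ R := le_max_right _ _
  -- Taking `|k|` and cutting off below `ε⁻¹` makes the cumulative integral monotone, continuous and
  -- bounded on all of `ℝ`.
  set k' : ℝ → ℝ := (Ici ε⁻¹).indicator fun r => |k r| with hk'
  have hk'int : Integrable k' := (integrable_indicator_iff measurableSet_Ici).2 hk.abs
  obtain ⟨hKc, hKm, hKb⟩ := cumulative_integral_properties hk'int
    fun r => indicator_nonneg (fun r _ => abs_nonneg (k r)) r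
  obtain ⟨R', c₁, c₂, hR', hc₁, -, hfar⟩ := hu.exists_sharp_decay (a := R) hσ hC
    (fun r hr => hpos r (by linarith)) (fun r hr => by
      have hr0 : 0 ≤ r := by linarith
      rw [primitive_truncation h.left_pos h.right_pos hr0 (hmem r hr0),
        truncation_eq hr0 (hmem r hr0)]
      exact (hcond r (u r) (hRε.trans hr) (hR₀ r (hRR₀.trans hr)).le).1)
    hKc hKm hKb (fun x y hx hxy => by
      have hx0 : 0 < x := by linarith
      have hy0 : 0 < y := by linarith
      set Δ : ℝ := (∫ r in (0 : ℝ)..y, k' r) - ∫ r in (0 : ℝ)..x, k' r with hΔ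
      have hΔ' : ∫ r in x..y, k' r = Δ :=
        (intervalIntegral.integral_interval_sub_left hk'int.intervalIntegrable
          hk'int.intervalIntegrable).symm
      have hcx := hu.continuous_right x
      have hsub : primitive (fun t => truncation a b g x t - Δ * t) (u y)
          = primitive (truncation a b g x) (u y) - Δ / 2 * u y ^ 2 := by
        rw [← primitive_linear]
        exact intervalIntegral.integral_sub (hcx.intervalIntegrable _ _)
          (Continuous.intervalIntegrable (by fun_prop) _ _)
      -- The bound on `g_r` is integrated in `r` for each fixed `t` between `0` and `u y`, where
      -- `|t| ≤ ε`, and only then in `t`.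
      have hle : primitive (fun t => truncation a b g x t - Δ * t) (u y)
          ≤ primitive (truncation a b g y) (u y) := by
        refine primitive_mono (by fun_prop) (hu.continuous_right y) fun t ht => ?_
        have htJ := uIcc_zero_subset h.left_pos h.right_pos (hmem y hy0.le) ht
        have htε : |t| ≤ ε := by
          have h1 : |t| ≤ |u y| := by simpa using abs_sub_left_of_mem_uIcc ht
          exact h1.trans (hR₀ y (by linarith)).le
        rw [truncation_eq hx0.le htJ, truncation_eq hy0.le htJ]
        have h2 := sub_mul_ge_of_partialR (k := k') (h.contDiffOn t) hx0 hxy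
          hk'int.intervalIntegrable fun r hr => by
            have hrε : ε⁻¹ ≤ r := hRε.trans (hx.trans hr.1)
            refine le_trans ?_ (hcond r t hrε htε).2
            rw [hk', indicator_of_mem (mem_Ici.2 hrε)]
            gcongr
            exact le_abs_self _
        rw [hΔ'] at h2
        linarith [sq t]
      rw [hsub] at hle
      linarith)
  exact hu.exists_two_sided_rate hR' (fun r hr => hpos r (hx₁.trans hr)) hc₁ hfar

end IsAdmissible

/-! ### The main theorem -/

theorem deriv_neg_of_even {u : ℝ → ℝ} (hu : Function.Even u) (r : ℝ) :
    deriv u (-r) = -deriv u r := by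
  have h := deriv_comp_neg u r
  rw [show (fun x => u (-x)) = u from funext hu] at h
  linarith

theorem isRadialSolution_zero {N : ℕ} {g : ℝ → ℝ → ℝ} (hg : ∀ r, 0 ≤ r → g r 0 = 0) :
    IsRadialSolution N g 0 fun _ => 0 where
  contDiff := contDiff_const
  even := fun _ => rfl
  ode := fun r hr => by simp [hg r hr.le]
  init := rfl
  init_deriv := by simp

theorem theorem2p6 (N : ℕ) (hN : 2 ≤ N) (g : ℝ → ℝ → ℝ) (gInf : ℝ → ℝ)
    (αLo αUp lam Lam α : ℝ)
    (hαLo : 0 < αLo) (hαUp : 0 < αUp) (hlam : 0 < lam) (hLam : 0 < Lam)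
    (hg_cont : ContinuousOn (Function.uncurry g) (Set.Ici 0 ×ˢ Set.univ))
    (hg_diff : ∀ z : ℝ, ContDiffOn ℝ 1 (fun r => g r z) (Set.Ici 0))
    (hgInf : LocallyLipschitz gInf)
    (hlim : TendstoUniformlyOn g gInf Filter.atTop (Set.Icc (-αLo) αUp))
    (hsign : ∀ r : ℝ, 0 ≤ r → ∀ z ∈ Set.Icc (-αLo) αUp, partialR g r z * z ≤ 0)
    (hgrowth : ∀ r : ℝ, 0 ≤ r → ∀ z ∈ Set.Icc (-αLo) αUp,
      lam * z ^ 2 ≤ gInf z * z ∧ gInf z * z ≤ g r z * z ∧ g r z * z ≤ Lam * z ^ 2)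
    (hα : α ∈ Set.Icc (-αLo) αUp)
    (hGα : primitive (g 0) α ≤ min (primitive gInf (-αLo)) (primitive gInf αUp)) :
    ∃ u : ℝ → ℝ,
      IsRadialSolution N g α u ∧ IsOscillating u ∧ IsLocalized u ∧
      (∀ r : ℝ, |u r| ≤ max αLo αUp) ∧
      (∀ r : ℝ, |deriv u r| ≤ Real.sqrt (2 * primitive (g 0) α)) ∧
      (AsymptoticConditions g →
        ∃ c C : ℝ, 0 < c ∧ 0 < C ∧ ∀ r : ℝ, 1 ≤ r →
          (α ≠ 0 → c * r ^ ((1 - (N : ℝ)) / 2) ≤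
            |u r| + |deriv u r| + |deriv (deriv u) r|) ∧
          |u r| + |deriv u r| + |deriv (deriv u) r| ≤ C * r ^ ((1 - (N : ℝ)) / 2)) := by
  have hadm : IsAdmissible g gInf αLo αUp lam Lam :=
    ⟨hαLo, hαUp, hlam, hLam, hg_cont, hg_diff, hgInf.continuous, hsign, hgrowth⟩
  rcases eq_or_ne α 0 with rfl | hα0
  -- For `α = 0` the zero solution serves, since `g r 0 = 0`; no lower rate is asked for.
  · refine ⟨fun _ => 0, isRadialSolution_zero fun r hr => hadm.apply_zero hr,
      ⟨fun n => n, tendsto_natCast_atTop_atTop, fun _ => rfl⟩, tendsto_const_nhds,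
      fun r => by simp [hαLo.le], fun r => by simp,
      fun _ => ⟨1, 1, one_pos, one_pos, fun r hr => ⟨fun h => absurd rfl h, ?_⟩⟩⟩
    have : 0 ≤ r ^ ((1 - (N : ℝ)) / 2) := Real.rpow_nonneg (by linarith) _
    simpa using this
  have hNd : ((N - 1 : ℕ) : ℝ) = (N : ℝ) - 1 := by
    rw [Nat.cast_sub (by omega), Nat.cast_one]
  have hd : 0 < (N : ℝ) - 1 := by
    have : (2 : ℝ) ≤ N := by exact_mod_cast hN
    linarith
  obtain ⟨u, hu2, hueven, hu0, hu0', hode⟩ := exists_radial_profile (N - 1)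
    (continuous_truncation (a := αLo) (b := αUp) hg_cont) hadm.abs_truncation_le α
  rw [hNd] at hode
  have hprof := hadm.isDampedProfile hd hu2 hu0' hode
  have hα' : u 0 ∈ Icc (-αLo) αUp := by rwa [hu0]
  have hmem : ∀ r, 0 ≤ r → u r ∈ Icc (-αLo) αUp := fun r hr =>
    hadm.mem_range hprof hα' (by rwa [hu0]) hr
  have hlin := hadm.isLinearlyBoundedProfile hprof hmem
  -- Nonvanishing propagates only from a positive radius, because `d/r` is singular at `0`. As `u 0
  -- = α ≠ 0`, one exists in `(0, 1]`, which covers all `r ≥ 1`.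
  obtain ⟨x₀, hx₀, hx₁, hux₀⟩ : ∃ x₀, 0 < x₀ ∧ x₀ ≤ 1 ∧ u x₀ ≠ 0 := by
    have h1 : ∀ᶠ x in 𝓝[>] (0 : ℝ), u x ≠ 0 :=
      (hprof.continuous.continuousAt.eventually_ne (by rwa [hu0])).filter_mono inf_le_left
    obtain ⟨x, hx, hx'⟩ := (h1.and (Ioc_mem_nhdsGT (zero_lt_one' ℝ))).exists
    exact ⟨x, hx'.1, hx'.2, hx⟩
  choose s hs hs0 using fun n : ℕ => hlin.exists_zero_ge n
  have hbound : ∀ r, 0 ≤ r → |u r| ≤ max αLo αUp := fun r hr => abs_le.2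
    ⟨by linarith [(hmem r hr).1, le_max_left αLo αUp], (hmem r hr).2.trans (le_max_right _ _)⟩
  have hbound' : ∀ r, 0 ≤ r → |deriv u r| ≤ Real.sqrt (2 * primitive (g 0) α) := fun r hr => by
    have h1 := hadm.energy_le hprof hα' hr
    have h2 := hprof.primitive_nonneg hr (u r)
    rw [energy, hu0] at h1
    exact Real.abs_le_sqrt (by linarith)
  refine ⟨u, ⟨hu2, hueven, fun r hr => ?_, hu0, hu0'⟩,
    ⟨s, tendsto_atTop_mono hs tendsto_natCast_atTop_atTop, hs0⟩,
    hlin.tendsto_zero (fun r hr => hlin.sq_add_sq_pos hx₀ hux₀ hr), fun r => ?_, fun r => ?_,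
    fun hg => ?_⟩
  · rw [hode r hr, truncation_eq hr.le (hmem r hr.le)]
  · rcases le_total 0 r with hr | hr
    · exact hbound r hr
    · rw [← hueven r]
      exact hbound (-r) (by linarith)
  · rcases le_total 0 r with hr | hr
    · exact hbound' r hr
    · have := hbound' (-r) (by linarith)
      rwa [deriv_neg_of_even hueven, abs_neg] at this
  · obtain ⟨c, C, hc, hC, hcC⟩ :=
      hadm.exists_two_sided_rate hlin hmem hx₀ hx₁ hux₀ hg
    refine ⟨c, C, hc, hC, fun r hr => ?_⟩
    rw [show (1 - (N : ℝ)) / 2 = -(((N : ℝ) - 1) / 2) by ring]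
    exact ⟨fun _ => (hcC r hr).1, (hcC r hr).2⟩
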